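/- Let $K$ be a local field of characteristic $p>0$ with valuation ring $R$ and residue field $k$, regarded as a subfield of $R$. Fix an algebraic closure $\bar K$ of $K$ with the extended valuation. For a finite extension $K'\subset\bar K$ of $K$ with valuation ring $R'$, let $k'\subset R'$ be its residue field and let $(R')^{per}=\bigcup_m (R')^{1/p^m}\subset\bar K$ be the perfection of $R'$; write $\mathrm{Spf}((R')^{per})$ for the formal spectrum of the completion of $(R')^{per}$ for the valuation topology (and similarly for $R$). For a complete valuation ring $A$ among these, a closed formal subscheme of $\mathrm{Spf}\,A[[x_1,\dots,x_n]]$ is one given by a closed ideal of $A[[x_1,\dots,x_n]]$. It is the union of finitely many closed formal subschemes if its ideal is the intersection of their ideals. It is called defined over a subring if it is the base change of a closed formal subscheme over that subring. Let $\mathscr G$ be a commutative formal group over $k$ which as a formal scheme is isomorphic to $\mathrm{Spf}\,k[[x_1,\dots,x_n]]$. Let $\bar\Gamma\subset\mathscr G(R^{per})$ be a subgroup which is a finitely generated $\mathbb Z_p$-module (for the unique $\mathbb Z_p$-module structure that is continuous for the valuation topology), where $\mathscr G(R^{per})$ is the group of points whose coordinates lie in the maximal ideal of the uncompleted ring $R^{per}$.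 Let $\mathscr X\subset\mathscr G_{\mathrm{Spf}(R^{per})}$ be a closed formal subscheme such that $\mathscr X(R^{per})\cap\bar\Gamma$ is formal-schematically dense in $\mathscr X$, that is, no closed formal subscheme of $\mathscr X$ other than $\mathscr X$ itself contains $\mathscr X(R^{per})\cap\bar\Gamma$. Then there exist a finite extension $K'\subset\bar K$ of $K$, with $R'$ and $k'$ as above, such that $\mathscr X_{\mathrm{Spf}((R')^{per})}$ is defined over $R'$, say by $\mathscr X_{\mathrm{Spf}(R')}\subset\mathscr G_{\mathrm{Spf}(R')}$, and there exist an integer $m\ge 0$, closed formal subschemes $\mathscr X_1,\dots,\mathscr X_m$ of $\mathscr X_{\mathrm{Spf}(R')}$ and elements $\gamma_1,\dots,\gamma_m\in\bar\Gamma\cap\mathscr G(R')$ such that each translate $\mathscr X_j+\gamma_j$ is defined over $k'$ and $$\mathscr X_{\mathrm{Spf}((R')^{per})}=\bigcup_{j=1}^m(\mathscr X_j)_{\mathrm{Spf}((R')^{per})}.$$ -/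

import Mathlib

open MvPowerSeries
open scoped MvPowerSeries.WithPiTopology

noncomputable section

namespace FormalML

/-! ### Valuation rings inside a complete ultrametric field -/

section Perfection

variable {C : Type*} [NormedField C]

/-- The perfection of `L` inside `C`: if `C` has characteristic `p > 0`, it consists of those `x`
with `x ^ p ^ m ∈ L` for some `m`.  Its valuation ring is the perfection of the valuation ring of
`L`. -/
def perf (L : Subfield C) : Subfield C :=
  (perfectClosure L C).toSubfield

/-- The completion, inside the complete field `C`, of the perfection of `L`.  Its valuation ring is
the completion of the perfection of the valuation ring of `L`. -/
def perfHat (L : Subfield C) : Subfield C :=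
  (perf L).topologicalClosure

theorem perfHat_mono {L M : Subfield C} (h : L ≤ M) : perfHat L ≤ perfHat M := by
  refine Subfield.topologicalClosure_minimal _ ?_ (Subfield.isClosed_topologicalClosure _)
  refine le_trans ?_ (Subfield.le_topologicalClosure _)
  rintro x ⟨m, y, hy⟩
  have e : ringExpChar L = ringExpChar M := by
    have h1 := expChar_of_injective_algebraMap (algebraMap L C).injective (ringExpChar L)
    have h2 := expChar_of_injective_algebraMap (algebraMap M C).injective (ringExpChar M)
    exact ExpChar.eq h1 h2
  refine ⟨m, ⟨y, h y.2⟩, ?_⟩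
  rw [← e]
  exact hy

theorem le_perfHat (L : Subfield C) : L ≤ perfHat L := by
  refine le_trans ?_ (Subfield.le_topologicalClosure _)
  intro x hx
  exact (perfectClosure L C).algebraMap_mem ⟨x, hx⟩

instance [CompleteSpace C] (L : Subfield C) : CompleteSpace (perfHat L) :=
  (Subfield.isClosed_topologicalClosure _).completeSpace_coe

instance {K : Type*} [NontriviallyNormedField K] [CompleteSpace K] [NormedAlgebra K C]
    (L : IntermediateField K C) [FiniteDimensional K L] : CompleteSpace L.toSubfield :=
  FiniteDimensional.complete K L

end Perfection

section Fields

variable {C : Type*} [NormedField C] [IsUltrametricDist C]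

/-- The valuation ring of a subfield `L` of the valued field `C`. -/
def valRing (L : Subfield C) : Subring C where
  carrier := {x | x ∈ L ∧ ‖x‖ ≤ 1}
  mul_mem' ha hb := ⟨L.mul_mem ha.1 hb.1, by
    rw [norm_mul]; exact mul_le_one₀ ha.2 (norm_nonneg _) hb.2⟩
  one_mem' := ⟨L.one_mem, by simp⟩
  add_mem' ha hb := ⟨L.add_mem ha.1 hb.1,
    (IsUltrametricDist.norm_add_le_max _ _).trans (max_le ha.2 hb.2)⟩
  zero_mem' := ⟨L.zero_mem, by simp⟩
  neg_mem' ha := ⟨L.neg_mem ha.1, by simpa using ha.2⟩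

theorem valRing_mono {L M : Subfield C} (h : L ≤ M) : valRing L ≤ valRing M :=
  fun _ hx => ⟨h hx.1, hx.2⟩

instance (L : Subfield C) : IsLinearTopology (valRing L) (valRing L) := by
  let B : ℝ → Ideal (valRing L) := fun r =>
    { carrier := {x | ‖x‖ < max r 0 ∨ x = 0}
      add_mem' := by
        rintro a b (ha | rfl) (hb | rfl)
        · exact Or.inl ((IsUltrametricDist.norm_add_le_max (a : C) b).trans_lt (max_lt ha hb))
        · simpa using Or.inl ha
        · simpa using Or.inl hb
        · simp
      zero_mem' := Or.inr rfl
      smul_mem' := by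
        rintro c x (hx | rfl)
        · refine Or.inl (lt_of_le_of_lt ?_ hx)
          change ‖(c : C) * (x : C)‖ ≤ ‖(x : C)‖
          rw [norm_mul]
          exact mul_le_of_le_one_left (norm_nonneg _) c.2.2
        · simp }
  refine IsLinearTopology.mk_of_hasBasis (S := Ideal (valRing L))
    (p := fun r : ℝ => 0 < r) (s := B) (valRing L) ?_
  have := Metric.nhds_basis_ball (x := (0 : valRing L))
  refine this.congr (fun _ => Iff.rfl) fun r hr => ?_
  ext x
  simp only [Metric.mem_ball, dist_zero_right]
  change _ ↔ (‖x‖ < max r 0 ∨ x = 0)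
  rw [max_eq_left hr.le]
  refine ⟨Or.inl, ?_⟩
  rintro (h | rfl)
  · exact h
  · simpa using hr

theorem isClosed_valRing {L : Subfield C} (h : IsClosed (L : Set C)) :
    IsClosed (valRing L : Set C) :=
  h.inter (isClosed_le continuous_norm continuous_const)

instance [CompleteSpace C] (L : Subfield C) [CompleteSpace L] : CompleteSpace (valRing L) :=
  (isClosed_valRing (completeSpace_coe_iff_isComplete.1
    (inferInstanceAs (CompleteSpace L))).isClosed).completeSpace_coe

/-- `κ` is the residue field of (the valuation ring of) `L`, viewed as a subfield of the valuation
ring: every element of the valuation ring is congruent modulo the maximal ideal to exactly one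
element of `κ`, that is, reduction is an isomorphism from `κ` to the residue field.  If `L` is a
local field of characteristic `p > 0`, there is exactly one such `κ`. -/
structure IsResidueField (κ L : Subfield C) : Prop where
  le : κ.toSubring ≤ valRing L
  existsUnique : ∀ x ∈ valRing L, ∃! c, c ∈ κ ∧ ‖x - c‖ < 1

/-- The inclusion of the valuation ring of `L` into that of a larger field `M`. -/
def inclusion {L M : Subfield C} (h : L ≤ M) : valRing L →+* valRing M :=
  Subring.inclusion (valRing_mono h)

/-- The inclusion of the residue field of `L` into the valuation ring of a field `M` that
contains `L`. -/
def IsResidueField.inclusion {κ L M : Subfield C} (h : IsResidueField κ L) (hLM : L ≤ M) :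
    κ →+* valRing M :=
  κ.subtype.codRestrict (valRing M) fun x => valRing_mono hLM (h.le x.2)

end Fields

/-! ### Closed formal subschemes of `Spf A[[x₁, …, xₙ]]` -/

section Schemes

/-- A closed formal subscheme of `Spf A[[x₁, …, xₙ]]`: a closed ideal of `A[[x₁, …, xₙ]]`, which
carries the product topology.  If `A` is a valuation ring with maximal ideal `𝔪` and its
valuation topology (resp. if `A` is discrete), this is the `(ϖ, x₁, …, xₙ)`-adic topology for any
nonzero `ϖ` in `𝔪` (resp. the `(x₁, …, xₙ)`-adic topology). -/
structure ClosedFormalSubscheme (A : Type*) [CommRing A] [TopologicalSpace A] (n : ℕ) where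
  ideal : Ideal (MvPowerSeries (Fin n) A)
  isClosed : IsClosed (ideal : Set (MvPowerSeries (Fin n) A))

variable {A B : Type*} [CommRing A] [CommRing B] {n : ℕ}

/-- The base change along `φ : A → B`: the ring of functions is
`B[[x]] / closure (I B[[x]])`, the completed tensor product of `A[[x]] / I` with `B`. -/
def ClosedFormalSubscheme.baseChange [TopologicalSpace A] [TopologicalSpace B]
    [IsTopologicalRing B] (φ : A →+* B) (X : ClosedFormalSubscheme A n) :
    ClosedFormalSubscheme B n where
  ideal := (X.ideal.map (MvPowerSeries.map φ)).closure
  isClosed := by rw [Ideal.coe_closure]; exact isClosed_closure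

/-- `X` is defined over `A`, where `φ : A → B`: it is the base change of a closed formal
subscheme of `Spf A[[x]]`. -/
def ClosedFormalSubscheme.IsDefinedOver [TopologicalSpace A] [TopologicalSpace B]
    [IsTopologicalRing B] (φ : A →+* B) (X : ClosedFormalSubscheme B n) : Prop :=
  ∃ Z : ClosedFormalSubscheme A n, Z.baseChange φ = X

/-- `X` is the union of the closed formal subschemes `Y j`. -/
def ClosedFormalSubscheme.IsUnion [TopologicalSpace A] (X : ClosedFormalSubscheme A n) {m : ℕ}
    (Y : Fin m → ClosedFormalSubscheme A n) : Prop :=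
  X.ideal = ⨅ j, (Y j).ideal

end Schemes

/-! ### Formal groups -/

/-- A commutative formal group over `A` whose underlying formal scheme is `Spf A[[x₁, …, xₙ]]`
with neutral element the origin: addition and negation are morphisms of formal schemes, that is,
tuples of power series, satisfying the axioms of a commutative group. -/
structure CommFormalGroup (A : Type*) [CommRing A] (n : ℕ) where
  add : Fin n → MvPowerSeries (Fin n ⊕ Fin n) A
  neg : Fin n → MvPowerSeries (Fin n) A
  constantCoeff_add : ∀ i, constantCoeff (add i) = 0
  constantCoeff_neg : ∀ i, constantCoeff (neg i) = 0
  zero_add : ∀ i, subst (Sum.elim 0 X : Fin n ⊕ Fin n → MvPowerSeries (Fin n) A) (add i) = X i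
  add_comm : ∀ i, subst
    (Sum.elim (fun j => X (.inr j)) (fun j => X (.inl j)) :
      Fin n ⊕ Fin n → MvPowerSeries (Fin n ⊕ Fin n) A) (add i) = add i
  add_assoc : ∀ i,
    subst (Sum.elim
      (fun j => subst (Sum.elim (fun l => X (.inl l)) (fun l => X (.inr (.inl l))) :
        Fin n ⊕ Fin n → MvPowerSeries (Fin n ⊕ Fin n ⊕ Fin n) A) (add j))
      (fun j => X (.inr (.inr j))) :
        Fin n ⊕ Fin n → MvPowerSeries (Fin n ⊕ Fin n ⊕ Fin n) A) (add i) =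
    subst (Sum.elim
      (fun j => X (.inl j))
      (fun j => subst (Sum.elim (fun l => X (.inr (.inl l))) (fun l => X (.inr (.inr l))) :
        Fin n ⊕ Fin n → MvPowerSeries (Fin n ⊕ Fin n ⊕ Fin n) A) (add j)) :
        Fin n ⊕ Fin n → MvPowerSeries (Fin n ⊕ Fin n ⊕ Fin n) A) (add i)
  neg_add_cancel : ∀ i,
    subst (Sum.elim neg X : Fin n ⊕ Fin n → MvPowerSeries (Fin n) A) (add i) = 0

namespace CommFormalGroup

section BaseChange

variable {A B : Type*} [CommRing A] [CommRing B] {n : ℕ}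

theorem hasSubst_elim {τ : Type*} {a b : Fin n → MvPowerSeries τ A}
    (ha : ∀ i, constantCoeff (a i) = 0) (hb : ∀ i, constantCoeff (b i) = 0) :
    HasSubst (Sum.elim a b) :=
  hasSubst_of_constantCoeff_zero (by rintro (i | i) <;> simp [ha, hb])

theorem map_subst_elim {τ : Type*} {a b : Fin n → MvPowerSeries τ A} (φ : A →+* B)
    (ha : ∀ i, constantCoeff (a i) = 0) (hb : ∀ i, constantCoeff (b i) = 0)
    (f : MvPowerSeries (Fin n ⊕ Fin n) A) :
    subst (Sum.elim (fun i => MvPowerSeries.map φ (a i)) (fun i => MvPowerSeries.map φ (b i)))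
      (MvPowerSeries.map φ f) = MvPowerSeries.map φ (subst (Sum.elim a b) f) := by
  rw [map_subst (hasSubst_elim ha hb)]
  congr 1
  ext1 (i | i) <;> rfl

theorem constantCoeff_subst_elim {τ : Type*} {a b : Fin n → MvPowerSeries τ A}
    (ha : ∀ i, constantCoeff (a i) = 0) (hb : ∀ i, constantCoeff (b i) = 0)
    {f : MvPowerSeries (Fin n ⊕ Fin n) A} (hf : constantCoeff f = 0) :
    constantCoeff (subst (Sum.elim a b) f) = 0 :=
  constantCoeff_subst_eq_zero (hasSubst_elim ha hb) (by rintro (i | i) <;> simp [ha, hb]) hf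

/-- The base change of a formal group along `φ`. -/
def map (φ : A →+* B) (G : CommFormalGroup A n) : CommFormalGroup B n where
  add i := MvPowerSeries.map φ (G.add i)
  neg i := MvPowerSeries.map φ (G.neg i)
  constantCoeff_add i := by simp [constantCoeff_map, G.constantCoeff_add]
  constantCoeff_neg i := by simp [constantCoeff_map, G.constantCoeff_neg]
  zero_add i := by
    have := map_subst_elim φ (a := (0 : Fin n → MvPowerSeries (Fin n) A)) (b := X)
      (by simp) (by simp) (G.add i)
    rw [G.zero_add, map_X] at this
    have e1 : (fun i => MvPowerSeries.map φ ((0 : Fin n → MvPowerSeries (Fin n) A) i)) =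
      (0 : Fin n → MvPowerSeries (Fin n) B) := by funext j; simp
    have e2 : (fun i => MvPowerSeries.map φ (X i : MvPowerSeries (Fin n) A)) = X := by
      funext j; simp
    rwa [e1, e2] at this
  add_comm i := by
    have := map_subst_elim φ
      (a := fun j => (X (.inr j) : MvPowerSeries (Fin n ⊕ Fin n) A)) (b := fun j => X (.inl j))
      (by simp) (by simp) (G.add i)
    rw [G.add_comm] at this
    simpa using this
  add_assoc i := by
    have h1 := fun j => map_subst_elim φ
      (a := fun l => (X (.inl l) : MvPowerSeries (Fin n ⊕ Fin n ⊕ Fin n) A))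
      (b := fun l => X (.inr (.inl l))) (by simp) (by simp) (G.add j)
    have h2 := fun j => map_subst_elim φ
      (a := fun l => (X (.inr (.inl l)) : MvPowerSeries (Fin n ⊕ Fin n ⊕ Fin n) A))
      (b := fun l => X (.inr (.inr l))) (by simp) (by simp) (G.add j)
    simp only [map_X] at h1 h2
    simp only [h1, h2]
    have h3 := map_subst_elim φ
      (a := fun j => subst (Sum.elim (fun l => X (.inl l)) (fun l => X (.inr (.inl l))) :
        Fin n ⊕ Fin n → MvPowerSeries (Fin n ⊕ Fin n ⊕ Fin n) A) (G.add j))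
      (b := fun j => X (.inr (.inr j)))
      (fun j => constantCoeff_subst_elim (by simp) (by simp) (G.constantCoeff_add j))
      (by simp) (G.add i)
    have h4 := map_subst_elim φ
      (a := fun j => (X (.inl j) : MvPowerSeries (Fin n ⊕ Fin n ⊕ Fin n) A))
      (b := fun j => subst (Sum.elim (fun l => X (.inr (.inl l))) (fun l => X (.inr (.inr l))) :
        Fin n ⊕ Fin n → MvPowerSeries (Fin n ⊕ Fin n ⊕ Fin n) A) (G.add j))
      (by simp)
      (fun j => constantCoeff_subst_elim (by simp) (by simp) (G.constantCoeff_add j))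
      (G.add i)
    simp only [map_X] at h3 h4
    rw [h3, h4, G.add_assoc]
  neg_add_cancel i := by
    have := map_subst_elim φ (a := G.neg) (b := X) G.constantCoeff_neg (by simp) (G.add i)
    rw [G.neg_add_cancel, map_zero] at this
    have e2 : (fun i => MvPowerSeries.map φ (X i : MvPowerSeries (Fin n) A)) = X := by
      funext j; simp
    rwa [e2] at this

end BaseChange

section Points

variable {A : Type*} [CommRing A] [UniformSpace A] {n : ℕ}

/-- The points of the formal group `G` with values in the topological ring `A`: tuples of
topologically nilpotent elements of `A`.  If `A` is a valuation ring with its valuation topology,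
these are the tuples of elements of the maximal ideal. -/
@[nolint unusedArguments]
def Points (_G : CommFormalGroup A n) : Type _ :=
  {v : Fin n → A // ∀ i, IsTopologicallyNilpotent (v i)}

variable {G : CommFormalGroup A n}

/-- The coordinates of a point. -/
def Points.coord (v : G.Points) : Fin n → A := v.1

@[ext]
theorem Points.ext {v w : G.Points} (h : ∀ i, v.coord i = w.coord i) : v = w :=
  Subtype.ext (funext h)

theorem Points.hasEval (v : G.Points) : HasEval v.coord :=
  ⟨v.2, by rw [Filter.cofinite_eq_bot]; exact Filter.tendsto_bot⟩

theorem Points.hasEval_elim (v w : G.Points) : HasEval (Sum.elim v.coord w.coord) :=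
  ⟨by rintro (i | i); exacts [v.2 i, w.2 i],
    by rw [Filter.cofinite_eq_bot]; exact Filter.tendsto_bot⟩

/-- The topology on the set of points induced by the topology of `A`. -/
instance : TopologicalSpace G.Points := TopologicalSpace.induced Points.coord inferInstance

instance : Zero G.Points := ⟨⟨0, fun _ => .zero⟩⟩

theorem Points.coord_zero (i : Fin n) : (0 : G.Points).coord i = 0 := rfl

theorem hasEval_X_C [IsLinearTopology A A] (v : G.Points) :
    HasEval (Sum.elim X (fun j => MvPowerSeries.C (v.coord j)) :
      Fin n ⊕ Fin n → MvPowerSeries (Fin n) A) :=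
  ⟨by
    rintro (i | i)
    · exact HasEval.X.hpow i
    · exact MvPowerSeries.LinearTopology.isTopologicallyNilpotent_of_constantCoeff (by simpa using! v.2 i),
    by rw [Filter.cofinite_eq_bot]; exact Filter.tendsto_bot⟩

variable [IsUniformAddGroup A] [CompleteSpace A] [T2Space A] [IsTopologicalRing A]
  [IsLinearTopology A A]

theorem aeval_map_eq_eval₂ {R : Type*} [CommRing R] [UniformSpace R] [DiscreteUniformity R]
    (φ : R →+* A) {σ : Type*} {b : σ → A} (hb : HasEval b) (f : MvPowerSeries σ R) :
    aeval (R := A) hb (MvPowerSeries.map φ f) = eval₂ φ b f := by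
  have h1 := hasSum_eval₂ (continuous_algebraMap A A) hb (MvPowerSeries.map φ f)
  rw [← coe_aeval hb] at h1
  have h2 := hasSum_eval₂ (φ := φ) continuous_of_discreteTopology hb f
  simp only [coeff_map, Algebra.algebraMap_self, RingHom.id_apply] at h1
  exact h1.unique h2

theorem aeval_map_subst {R : Type*} [CommRing R] [UniformSpace R] [DiscreteUniformity R]
    (φ : R →+* A) {σ τ : Type*} {a : σ → MvPowerSeries τ R} (ha : HasSubst a) {b : τ → A}
    (hb : HasEval b) {c : σ → A} (hc : HasEval c)
    (h : ∀ s, aeval (R := A) hb (MvPowerSeries.map φ (a s)) = c s) (f : MvPowerSeries σ R) :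
    aeval (R := A) hb (MvPowerSeries.map φ (subst a f)) =
      aeval (R := A) hc (MvPowerSeries.map φ f) := by
  let : Algebra R A := φ.toAlgebra
  have := eval₂_subst (R := R) (S := R) ha hb f
  rw [aeval_map_eq_eval₂, aeval_map_eq_eval₂]
  refine this.trans ?_
  congr 1
  funext s
  rw [← h s, aeval_map_eq_eval₂]
  rfl

theorem aeval_subst {σ τ : Type*} {a : σ → MvPowerSeries τ A} (ha : HasSubst a) {b : τ → A}
    (hb : HasEval b) {c : σ → A} (hc : HasEval c) (h : ∀ s, aeval (R := A) hb (a s) = c s)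
    (f : MvPowerSeries σ A) :
    aeval (R := A) hb (subst a f) = aeval (R := A) hc f := by
  have := @aeval_map_subst A _ _ _ _ _ _ _ A _ ⊥ (@DiscreteUniformity.mk A ⊥ rfl) (RingHom.id A) σ τ a ha b hb c hc
    (by simpa using h) f
  simpa using this

theorem aeval_nilpotent {σ : Type*} {b : σ → A} (hb : HasEval b) {f : MvPowerSeries σ A}
    (hf : constantCoeff f = 0) : IsTopologicallyNilpotent (aeval (R := A) hb f) := by
  have : IsTopologicallyNilpotent f := MvPowerSeries.LinearTopology.isTopologicallyNilpotent_of_constantCoeff (by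
    rw [hf]; exact IsTopologicallyNilpotent.zero)
  exact this.map (φ := (aeval (R := A) hb : MvPowerSeries σ A →ₐ[A] A)) (continuous_aeval hb)

instance : Add G.Points :=
  ⟨fun v w => ⟨fun i => aeval (R := A) (v.hasEval_elim w) (G.add i),
    fun i => aeval_nilpotent _ (G.constantCoeff_add i)⟩⟩

instance : Neg G.Points :=
  ⟨fun v => ⟨fun i => aeval (R := A) v.hasEval (G.neg i),
    fun i => aeval_nilpotent _ (G.constantCoeff_neg i)⟩⟩

theorem Points.coord_add (v w : G.Points) (i : Fin n) :
    (v + w).coord i = aeval (R := A) (v.hasEval_elim w) (G.add i) := rfl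

theorem Points.coord_neg (v : G.Points) (i : Fin n) :
    (-v).coord i = aeval (R := A) v.hasEval (G.neg i) := rfl

theorem aeval_X' {σ : Type*} {b : σ → A} (hb : HasEval b) (s : σ) :
    aeval (R := A) hb (X s : MvPowerSeries σ A) = b s := by
  rw [coe_aeval, eval₂_X]

/-- The group structure on the set of points. -/
instance : AddCommGroup G.Points where
  add_assoc u v w := by
    have hE : HasEval (Sum.elim u.coord (Sum.elim v.coord w.coord)) :=
      ⟨by rintro (i | i | i); exacts [u.2 i, v.2 i, w.2 i],
        by rw [Filter.cofinite_eq_bot]; exact Filter.tendsto_bot⟩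
    ext i
    have h := congrArg (aeval (R := A) hE) (G.add_assoc i)
    rw [aeval_subst (hasSubst_elim (fun j => constantCoeff_subst_elim (by simp) (by simp)
        (G.constantCoeff_add j)) (by simp)) hE ((u + v).hasEval_elim w),
      aeval_subst (hasSubst_elim (by simp) (fun j => constantCoeff_subst_elim (by simp) (by simp)
        (G.constantCoeff_add j))) hE (u.hasEval_elim (v + w))] at h
    · exact h
    · rintro (j | j)
      · simp [aeval_X']
      · simp only [Sum.elim_inr, Points.coord_add]
        refine aeval_subst (hasSubst_elim (by simp) (by simp)) hE _ ?_ _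
        rintro (l | l) <;> simp [aeval_X']
    · rintro (j | j)
      · simp only [Sum.elim_inl, Points.coord_add]
        refine aeval_subst (hasSubst_elim (by simp) (by simp)) hE _ ?_ _
        rintro (l | l) <;> simp [aeval_X']
      · simp [aeval_X']
  zero_add v := by
    ext i
    have h := congrArg (aeval (R := A) v.hasEval) (G.zero_add i)
    rw [aeval_subst (hasSubst_elim (by simp) (by simp)) v.hasEval
      ((0 : G.Points).hasEval_elim v) (by
        rintro (j | j)
        · simp [Points.coord_zero]
        · simp [aeval_X']), aeval_X'] at h
    exact h
  add_zero v := by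
    ext i
    have h := congrArg (aeval (R := A) v.hasEval) (G.zero_add i)
    rw [← G.add_comm, aeval_subst (hasSubst_elim (by simp) (by simp)) v.hasEval
      ((0 : G.Points).hasEval_elim v) (by
        rintro (j | j)
        · simp [Points.coord_zero]
        · simp [aeval_X']), aeval_X'] at h
    rw [aeval_subst (hasSubst_elim (by simp) (by simp)) ((0 : G.Points).hasEval_elim v)
      (v.hasEval_elim 0) (by rintro (j | j) <;> simp [aeval_X'])] at h
    exact h
  add_comm v w := by
    ext i
    have h := congrArg (aeval (R := A) (v.hasEval_elim w)) (G.add_comm i)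
    rw [aeval_subst (hasSubst_elim (by simp) (by simp)) (v.hasEval_elim w)
      (w.hasEval_elim v) (by rintro (j | j) <;> simp [aeval_X'])] at h
    exact h.symm
  neg_add_cancel v := by
    ext i
    have h := congrArg (aeval (R := A) v.hasEval) (G.neg_add_cancel i)
    rw [aeval_subst (hasSubst_elim G.constantCoeff_neg (by simp)) v.hasEval
      ((-v).hasEval_elim v) (by
        rintro (j | j)
        · simp [Points.coord_neg]
        · simp [aeval_X']), map_zero] at h
    exact h
  nsmul := nsmulRec
  zsmul := zsmulRec

/-- The point `v` lies on the closed formal subscheme `X`. -/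
def Points.LiesOn (v : G.Points) (X : ClosedFormalSubscheme A n) : Prop :=
  ∀ f ∈ X.ideal, aeval (R := A) v.hasEval f = 0

/-- The set `T` of points is formal-schematically dense in `X`: it is contained in `X`, and every
closed formal subscheme of `X` which contains `T` is equal to `X`. -/
def FormallyDense (T : Set G.Points) (X : ClosedFormalSubscheme A n) : Prop :=
  (∀ v ∈ T, v.LiesOn X) ∧
    ∀ Y : ClosedFormalSubscheme A n, X.ideal ≤ Y.ideal → (∀ v ∈ T, v.LiesOn Y) →
      Y.ideal = X.ideal

/-- The `i`-th coordinate of `x + v`, where `x` is the tuple of variables: the power series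
`G_i(x, v)` in `x`. -/
def translateCoord (v : G.Points) (i : Fin n) : MvPowerSeries (Fin n) A :=
  aeval (R := A) (hasEval_X_C v) (G.add i)

theorem hasEval_translateCoord (v : G.Points) : HasEval (translateCoord v) :=
  ⟨fun i => by
    have h1 : IsTopologicallyNilpotent (G.add i) := MvPowerSeries.LinearTopology.isTopologicallyNilpotent_of_constantCoeff (by
      rw [G.constantCoeff_add]; exact IsTopologicallyNilpotent.zero)
    exact h1.map (φ := (aeval (R := A) (hasEval_X_C v) :
      MvPowerSeries (Fin n ⊕ Fin n) A →ₐ[A] MvPowerSeries (Fin n) A)) (continuous_aeval _),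
    by rw [Filter.cofinite_eq_bot]; exact Filter.tendsto_bot⟩

/-- Pullback of functions along the translation `x ↦ x + v`, that is, `f(x) ↦ f(x + v)`. -/
def translation (v : G.Points) : MvPowerSeries (Fin n) A →ₐ[A] MvPowerSeries (Fin n) A :=
  aeval (hasEval_translateCoord v)

/-- The translate `X + v`.  A function `f` vanishes on `X + v` if and only if `f(x + v)` vanishes
on `X`. -/
def translate (X : ClosedFormalSubscheme A n) (v : G.Points) : ClosedFormalSubscheme A n where
  ideal := X.ideal.comap (translation v)
  isClosed := X.isClosed.preimage (continuous_aeval _)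

end Points

end CommFormalGroup

end FormalML

end

/-!
Let `q = p ^ m`. In characteristic `p`, multiplication by `p` on a commutative formal group over `k`
is a power series in the `p`-th powers of the coordinates: the `p`-fold sum is symmetric in its
summands, so on the diagonal the monomials that are not fixed by a cyclic permutation of the
summands cancel (`coord_nsmul_mem`). As `k` is perfect, `q` times a point with coordinates in a
local field `L` has coordinates in `L ^ q` (`IsLocalSubfield.isRational_nsmul`).

The module `Γ` is finitely generated, so its points have coordinates in `L = K ^ (1 / q)` for some
`q` (`exists_forall_isRational`). This field is a finite extension of `K` with the same residue
field, and it serves as `K'`, with `k' = k`. The scheme `X` is cut out by the power series that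
vanish on a set `T` of points in `Γ`.

*Descent from the perfection to `L`.* A power series `f` over the completed perfection of `L` that
vanishes on `T` is a limit of combinations of such power series over `L`. Indeed, a local field is
spherically complete, so there is a norm-decreasing linear projection of `C` onto
`L ^ (1 / q)` (`IsLocalSubfield.exists_projection`); applied to the coefficients, it replaces `f` by
a power series over `L ^ (1 / q)`, which still vanishes on `T`. The powers `t ^ i`, `i < q`, of a
uniformizer `t` form a basis of a valuation ring over its subring of `q`-th powers, and the
components of a power series with respect to this basis vanish on `T` as well
(`IsLocalSubfield.exists_coeff_eq_sum`).

*Descent from `L` to `k`.* If an ideal `J` of power series over `L` is the vanishing ideal of a set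
of points over `L ^ q`, then, by the same basis, it is generated by power series over `L ^ q`. These
are congruent modulo `t ^ q` to power series over `k`. If this holds for infinitely many `q`, then
`J` is topologically generated by power series over `k` (`IsLocalSubfield.le_closure_map_comap`).

*Decomposition.* For `γ` in `Γ`, the vanishing ideals of `T ∩ (γ + p ^ N Γ)` increase with `N`, so
they are constant for large `N` because the ring of power series over the valuation ring of `L` is
noetherian. The translate of this ideal by `-γ` is then the vanishing ideal of a set of points of
`p ^ N Γ` for every large `N`, so it is defined over `k`. By compactness of `Γ`, finitely many of
the residue classes `γ + p ^ N Γ` cover `Γ` (`exists_cover_isDefinedOver`).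
-/

noncomputable section

namespace FormalML

/-! ### Functoriality of points and evaluation -/

section Uncurry

variable {A : Type*} [CommRing A] [UniformSpace A] {n : ℕ}

theorem CommFormalGroup.Points.hasEval_uncurry {G : CommFormalGroup A n} {ι : Type*} [Finite ι]
    (w : ι → G.Points) : HasEval (fun x : ι × Fin n => (w x.1).coord x.2) :=
  ⟨fun x => (w x.1).2 x.2, by rw [Filter.cofinite_eq_bot]; exact Filter.tendsto_bot⟩

end Uncurry

section Functoriality

variable {A B : Type*} [CommRing A] [UniformSpace A] [IsUniformAddGroup A] [CompleteSpace A]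
  [T2Space A] [IsTopologicalRing A] [IsLinearTopology A A]
  [CommRing B] [UniformSpace B] [IsUniformAddGroup B] [CompleteSpace B]
  [T2Space B] [IsTopologicalRing B] [IsLinearTopology B B] {n : ℕ}

theorem map_aeval {σ : Type*} (ψ : A →+* B) (hψ : Continuous ψ) {a : σ → A} (ha : HasEval a)
    {b : σ → B} (hb : HasEval b) (hab : ∀ s, ψ (a s) = b s) (f : MvPowerSeries σ A) :
    ψ (aeval (R := A) ha f) = aeval (R := B) hb (MvPowerSeries.map ψ f) := by
  have h1 := (hasSum_aeval (R := A) ha f).map ψ hψ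
  have h2 := hasSum_aeval (R := B) hb (MvPowerSeries.map ψ f)
  refine h1.unique ?_
  convert! h2 using 2 with d
  simp [Finsupp.prod, hab]

namespace CommFormalGroup

/-- The homomorphism on points induced by a continuous ring homomorphism `ψ : A → B`, where `H` is
the base change of `G` along `ψ`. -/
def Points.map {G : CommFormalGroup A n} {H : CommFormalGroup B n} (ψ : A →+* B)
    (hψ : Continuous ψ) (h : ∀ i, H.add i = MvPowerSeries.map ψ (G.add i)) :
    G.Points →+ H.Points where
  toFun v := ⟨fun i => ψ (v.coord i), fun i => (v.2 i).map hψ⟩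
  map_zero' := Points.ext fun i => map_zero ψ
  map_add' v w := by
    ext i
    change ψ (aeval (R := A) (v.hasEval_elim w) (G.add i)) = aeval (R := B)
      (Points.hasEval_elim (G := H) ⟨fun i => ψ (v.coord i), fun i => (v.2 i).map hψ⟩
        ⟨fun i => ψ (w.coord i), fun i => (w.2 i).map hψ⟩) (H.add i)
    rw [h]
    refine map_aeval ψ hψ (v.hasEval_elim w) _ ?_ _
    rintro (j | j) <;> rfl

@[simp]
theorem Points.coord_map {G : CommFormalGroup A n} {H : CommFormalGroup B n} (ψ : A →+* B)
    (hψ : Continuous ψ) (h : ∀ i, H.add i = MvPowerSeries.map ψ (G.add i)) (v : G.Points)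
    (i : Fin n) : (Points.map ψ hψ h v).coord i = ψ (v.coord i) := rfl

theorem aeval_translateCoord {G : CommFormalGroup A n} (v w : G.Points) (i : Fin n) :
    aeval (R := A) v.hasEval (translateCoord w i) = (v + w).coord i := by
  have h := comp_aeval (R := A) (hasEval_X_C w) (ε := aeval (R := A) v.hasEval)
    (continuous_aeval _)
  have h2 := DFunLike.congr_fun h (G.add i)
  rw [AlgHom.comp_apply] at h2
  rw [translateCoord, h2, Points.coord_add]
  congr! 2
  ext1 (j | j)
  · simp [aeval_X']
  · simp only [Sum.elim_inr]
    rw [MvPowerSeries.c_eq_algebraMap]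
    exact AlgHom.commutes _ _

/-- The value at `v` of `f(x + w)` is the value of `f` at `v + w`. -/
theorem aeval_translation {G : CommFormalGroup A n} (v w : G.Points) (f : MvPowerSeries (Fin n) A) :
    aeval (R := A) v.hasEval (translation w f) = aeval (R := A) (v + w).hasEval f := by
  have h := comp_aeval (R := A) (hasEval_translateCoord w) (ε := aeval (R := A) v.hasEval)
    (continuous_aeval _)
  have h2 := DFunLike.congr_fun h f
  rw [AlgHom.comp_apply] at h2
  rw [translation, h2]
  congr! 2
  ext1 i
  exact aeval_translateCoord v w i

end CommFormalGroup

end Functoriality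

/-! ### The `p`-fold sum as a symmetric power series -/

namespace CommFormalGroup

section Universal

variable {k : Type*} [CommRing k] [UniformSpace k] [DiscreteUniformity k] {n : ℕ}
  {ι : Type*} [Fintype ι]

instance : IsLinearTopology k k :=
  IsLinearTopology.mk_of_hasBasis (S := Ideal k) (p := fun _ : Unit => True) (s := fun _ => ⊥) k (by
    rw [nhds_discrete]
    simpa using Filter.hasBasis_pure (0 : k))

/-- The `j`-th universal point: its coordinates are the variables with first index `j`. -/
def universalPoint (F : CommFormalGroup k n) (j : ι) :
    (F.map (C : k →+* MvPowerSeries (ι × Fin n) k)).Points :=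
  ⟨fun l => X (j, l), fun _ =>
    WithPiTopology.isTopologicallyNilpotent_of_constantCoeff_zero (constantCoeff_X _)⟩

/-- The sum of points indexed by `ι` as a family of power series in the coordinates of the
points. -/
def sumSeries (F : CommFormalGroup k n) (i : Fin n) : MvPowerSeries (ι × Fin n) k :=
  (∑ j : ι, F.universalPoint j).coord i

/-- The series `sumSeries` computes sums of points over all `k`-algebras, by specialization of the
universal points. -/
theorem coord_sum (F : CommFormalGroup k n)
    {A : Type*} [CommRing A] [UniformSpace A] [IsUniformAddGroup A] [CompleteSpace A]
    [T2Space A] [IsTopologicalRing A] [IsLinearTopology A A] (φ : k →+* A)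
    (w : ι → (F.map φ).Points) (i : Fin n) :
    (∑ j, w j).coord i = eval₂ φ (fun x : ι × Fin n => (w x.1).coord x.2) (F.sumSeries i) := by
  have hφ : Continuous φ := continuous_of_discreteTopology
  have hw := Points.hasEval_uncurry w
  let ψ := eval₂Hom hφ hw
  have hψ : ⇑ψ = eval₂ φ (fun x : ι × Fin n => (w x.1).coord x.2) := coe_eval₂Hom hφ hw
  have hc : Continuous ψ := by rw [hψ]; exact continuous_eval₂ hφ hw
  have hcomp : ψ.comp C = φ := by ext c; simp [hψ]
  let Ψ : (F.map (C : k →+* MvPowerSeries (ι × Fin n) k)).Points →+ (F.map φ).Points :=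
    Points.map ψ hc fun i => by
      change MvPowerSeries.map φ _ = MvPowerSeries.map ψ (MvPowerSeries.map C _)
      rw [← RingHom.comp_apply (MvPowerSeries.map ψ), ← MvPowerSeries.map_comp, hcomp]
  have hΨ : ∀ j, Ψ (F.universalPoint j) = w j := fun j => Points.ext fun l => by
    change ψ (X (j, l)) = _
    rw [hψ, eval₂_X]
  rw [← hψ, sumSeries, ← Points.coord_map (G := F.map C) (H := F.map φ) ψ hc]
  change _ = (Ψ _).coord i
  rw [map_sum]
  simp only [hΨ]

/-- The series `sumSeries` is symmetric in the summands. -/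
theorem coeff_sumSeries_equivMapDomain (F : CommFormalGroup k n) (σ : Equiv.Perm ι) (i : Fin n)
    (β : ι × Fin n →₀ ℕ) :
    coeff (β.equivMapDomain (σ.prodCongr (Equiv.refl _))) (F.sumSeries i) =
      coeff β (F.sumSeries i) := by
  classical
  have h := F.coord_sum (C : k →+* MvPowerSeries (ι × Fin n) k)
    (fun j => F.universalPoint (σ j)) i
  rw [Equiv.sum_comp σ (fun j => F.universalPoint j)] at h
  have hs := hasSum_eval₂ (φ := (C : k →+* MvPowerSeries (ι × Fin n) k))
    continuous_of_discreteTopology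
    (Points.hasEval_uncurry fun j : ι => F.universalPoint (σ j)) (F.sumSeries i)
  rw [← h] at hs
  have hs' := hs.map (coeff (R := k) (β.equivMapDomain (σ.prodCongr (Equiv.refl _))))
    (WithPiTopology.continuous_coeff _ _)
  refine hs'.unique ?_
  convert! hasSum_ite_eq β (coeff β (F.sumSeries i)) using 2 with d
  have hprod : (d.prod fun s e => ((F.universalPoint (σ s.1)).coord s.2) ^ e) =
      monomial (R := k) (d.equivMapDomain (σ.prodCongr (Equiv.refl _))) 1 := by
    rw [monomial_eq', map_one, one_mul, Finsupp.prod_equivMapDomain]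
    rfl
  rw [Function.comp_apply, hprod, coeff_C_mul, coeff_monomial]
  have : (β.equivMapDomain (σ.prodCongr (Equiv.refl (Fin n))) =
      d.equivMapDomain (σ.prodCongr (Equiv.refl _))) ↔ d = β :=
    ⟨fun h => ((Finsupp.equivCongrLeft _).injective h).symm, fun h => by rw [h]⟩
  simp only [this]
  split_ifs with h
  · simp [h]
  · simp

end Universal

/-- In characteristic `p`, the terms of a `σ`-invariant sum that are not fixed by `σ` cancel if
`σ ^ p = 1`, because they come in orbits of length `p`. -/
theorem sum_mem_of_perm {α A : Type*} [Ring A] {p : ℕ} [Fact p.Prime] [CharP A p] {s : Finset α}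
    {σ : Equiv.Perm α} (hσ : σ ^ p = 1) (hs : ∀ x, x ∈ s ↔ σ x ∈ s) {a : α → A}
    (ha : ∀ x, a (σ x) = a x) (N : AddSubgroup A) (hN : ∀ x ∈ s, σ x = x → a x ∈ N) :
    ∑ x ∈ s, a x ∈ N := by
  classical
  rw [show ∑ x ∈ s, a x = ∑ y ∈ s.image a, (s.filter (a · = y)).card • y from
    Finset.sum_comp (s := s) (id : A → A) a]
  refine sum_mem fun y _ => ?_
  have hu : ∀ x, (x ∈ s ∧ a x = y) ↔ (σ x ∈ s ∧ a (σ x) = y) := fun x => by rw [ha, hs x]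
  let τ : Equiv.Perm {x // x ∈ s.filter (a · = y)} :=
    σ.subtypePerm fun x => by simpa using (hu x).symm
  have hτ : τ ^ p ^ 1 = 1 := by
    rw [pow_one]
    ext x
    simp [τ, Equiv.Perm.subtypePerm_pow, hσ]
  by_cases hp : p ∣ Fintype.card {x // x ∈ s.filter (a · = y)}
  · rw [Fintype.card_coe] at hp
    rw [nsmul_eq_mul, (CharP.cast_eq_zero_iff A p _).2 hp, zero_mul]
    exact N.zero_mem
  · obtain ⟨x, hx⟩ := Equiv.Perm.exists_fixed_point_of_prime hp hτ
    have hxs := Finset.mem_filter.1 x.2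
    refine nsmul_mem ?_ _
    have := hN x hxs.1 (congrArg Subtype.val hx)
    rwa [hxs.2] at this

/-- Multiplication by `p` factors through the Frobenius: in the `p`-fold sum, the monomials that
are not fixed by cyclic permutation of the summands cancel on the diagonal. -/
theorem coord_nsmul_mem {k A : Type*} [CommRing k] {n : ℕ} (F : CommFormalGroup k n)
    [CommRing A] [UniformSpace A] [IsUniformAddGroup A] [CompleteSpace A]
    [T2Space A] [IsTopologicalRing A] [IsLinearTopology A A] (φ : k →+* A)
    (p : ℕ) [Fact p.Prime] [CharP A p] (N : Subring A) (hN : IsClosed (N : Set A))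
    (hφ : ∀ c, φ c ∈ N) (v : (F.map φ).Points) (hv : ∀ i, v.coord i ^ p ∈ N) (i : Fin n) :
    (p • v).coord i ∈ N := by
  let : UniformSpace k := ⊥
  have : DiscreteUniformity k := ⟨rfl⟩
  have hs : p • v = ∑ _j : ZMod p, v := by simp [ZMod.card]
  have hsum := hasSum_eval₂ (φ := φ) continuous_of_discreteTopology
    (Points.hasEval_uncurry fun _ : ZMod p => v) (F.sumSeries i)
  rw [hs, coord_sum]
  -- cyclic permutation of the `p` summands, acting on exponents of monomials
  let σ : Equiv.Perm (ZMod p × Fin n →₀ ℕ) :=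
    Finsupp.equivCongrLeft ((Equiv.addRight (1 : ZMod p)).prodCongr (Equiv.refl (Fin n)))
  have hσa : ∀ (β : ZMod p × Fin n →₀ ℕ) j l, σ β (j, l) = β (j - 1, l) := fun β j l => by
    simp [σ, Finsupp.equivMapDomain_apply, sub_eq_add_neg]
  have hσpow : ∀ (m : ℕ) (β : ZMod p × Fin n →₀ ℕ) j l, (σ ^ m) β (j, l) = β (j - m, l) := by
    intro m
    induction m with
    | zero => simp
    | succ m ih =>
      intro β j l
      rw [pow_succ', Equiv.Perm.mul_apply, hσa, ih]
      push_cast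
      congr 2
      ring
  have hσp : σ ^ p = 1 := by
    ext β ⟨j, l⟩
    rw [hσpow]
    simp
  -- the value is the limit of sums over boxes of exponents, which `σ` preserves
  have hlim : Filter.Tendsto (fun m : ℕ => Finset.Iic (Finsupp.equivFunOnFinite.symm
      (fun _ : ZMod p × Fin n => m))) Filter.atTop Filter.atTop := by
    refine Filter.tendsto_atTop_finset_of_monotone ?_ ?_
    · exact fun a b hab => Finset.Iic_subset_Iic.2 fun x => hab
    · exact fun β => ⟨∑ x, β x, Finset.mem_Iic.2 fun x =>
        Finset.single_le_sum (f := β) (fun _ _ => Nat.zero_le _) (Finset.mem_univ x)⟩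
  refine hN.mem_of_tendsto (hsum.comp hlim) (Filter.Eventually.of_forall fun m => ?_)
  refine sum_mem_of_perm hσp ?_ ?_ N.toAddSubgroup ?_
  · intro β
    simp only [Finset.mem_Iic, Finsupp.le_def, Finsupp.equivFunOnFinite_symm_apply_apply]
    constructor
    · rintro h ⟨j, l⟩
      rw [hσa]
      exact h _
    · rintro h ⟨j, l⟩
      have := h (j + 1, l)
      rwa [hσa, add_sub_cancel_right] at this
  · intro β
    congr 1
    · refine congrArg φ ?_
      exact coeff_sumSeries_equivMapDomain F _ i β
    · exact Finsupp.prod_equivMapDomain _ _ _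
  · intro β _ hβ
    refine N.mul_mem (hφ _) ?_
    -- a monomial fixed by `σ` is a product of `p`-th powers on the diagonal
    have hconst : ∀ (j : ZMod p) l, β (j, l) = β (0, l) := by
      intro j l
      have h := hσpow j.val β j l
      have h2 : (σ ^ j.val) β = β := Equiv.Perm.pow_apply_eq_self_of_apply_eq_self hβ _
      rw [h2] at h
      simpa using h
    rw [Finsupp.prod_fintype _ _ (by simp), Fintype.prod_prod_type_right]
    refine Subring.prod_mem _ fun l _ => ?_
    simp only [hconst]
    rw [Finset.prod_const, Finset.card_univ, ZMod.card, ← pow_mul, mul_comm, pow_mul]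
    exact N.pow_mem (hv l) _

end CommFormalGroup

/-! ### Local fields inside `C` -/

section LocalFields

variable {C : Type*} [NormedField C] [IsUltrametricDist C]

/-- `L` is a local field inside `C` with residue field `k`: its valuation ring is compact and its
valuation is discrete and nontrivial. -/
structure IsLocalSubfield (k L : Subfield C) : Prop where
  residue : IsResidueField k L
  isCompact : IsCompact (valRing L : Set C)
  exists_uniformizer : ∃ t ∈ L, 0 < ‖t‖ ∧ ‖t‖ < 1 ∧ ∀ x ∈ L, ‖x‖ < 1 → ‖x‖ ≤ ‖t‖

theorem norm_sub_le_max' (x y : C) : ‖x - y‖ ≤ max ‖x‖ ‖y‖ := by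
  rw [sub_eq_add_neg, ← norm_neg y]
  exact IsUltrametricDist.norm_add_le_max _ _

theorem isClosed_of_isClosed_valRing {L : Subfield C} (h : IsClosed (valRing L : Set C)) :
    IsClosed (L : Set C) := by
  refine isClosed_of_closure_subset fun x hx => ?_
  obtain ⟨y, hy, hxy⟩ := Metric.mem_closure_iff.1 hx 1 one_pos
  have : x - y ∈ closure (valRing L : Set C) := by
    refine Metric.mem_closure_iff.2 fun ε hε => ?_
    obtain ⟨z, hz, hxz⟩ := Metric.mem_closure_iff.1 hx (min ε 1) (lt_min hε one_pos)
    refine ⟨z - y, ⟨L.sub_mem hz hy, ?_⟩, ?_⟩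
    · rw [show z - y = (x - y) - (x - z) by ring]
      refine (norm_sub_le_max' _ _).trans (max_le ?_ ?_)
      · rw [← dist_eq_norm]; exact hxy.le
      · rw [← dist_eq_norm]; exact (hxz.trans_le (min_le_right _ _)).le
    · rw [dist_sub_right]; exact hxz.trans_le (min_le_left _ _)
  rw [h.closure_eq] at this
  simpa using L.add_mem this.1 hy

theorem IsResidueField.norm_eq_one {k L : Subfield C} (h : IsResidueField k L) {c : C} (hc : c ∈ k)
    (h0 : c ≠ 0) : ‖c‖ = 1 := by
  refine le_antisymm (h.le hc).2 ?_
  have h1 := (h.le (k.inv_mem hc : c⁻¹ ∈ k)).2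
  rw [norm_inv] at h1
  exact (inv_le_one₀ (norm_pos_iff.2 h0)).1 h1

theorem IsResidueField.eq_of_norm_sub_lt {k L : Subfield C} (h : IsResidueField k L) {c d : C}
    (hc : c ∈ k) (hd : d ∈ k) (hcd : ‖c - d‖ < 1) : c = d := by
  by_contra hne
  exact hcd.ne (h.norm_eq_one (k.sub_mem hc hd) (sub_ne_zero.2 hne))

namespace IsLocalSubfield

variable {k L : Subfield C}

theorem isClosed_valRing (h : IsLocalSubfield k L) : IsClosed (valRing L : Set C) :=
  h.isCompact.isClosed

theorem isClosed (h : IsLocalSubfield k L) : IsClosed (L : Set C) :=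
  isClosed_of_isClosed_valRing h.isClosed_valRing

theorem finite (h : IsLocalSubfield k L) : Finite k := by
  obtain ⟨s, -, hs, hcov⟩ := h.isCompact.finite_cover_balls one_pos
  have hc : ∀ c : k, ∃ x : s, (c : C) ∈ Metric.ball (x : C) 1 := fun c => by
    obtain ⟨x, hx, hcx⟩ := Set.mem_iUnion₂.1 (hcov (h.residue.le c.2))
    exact ⟨⟨x, hx⟩, hcx⟩
  choose g hg using hc
  have := hs.to_subtype
  refine Finite.of_injective g fun c d hcd => Subtype.ext ?_
  refine h.residue.eq_of_norm_sub_lt c.2 d.2 ?_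
  have h1 := hg c
  have h2 := hg d
  rw [hcd] at h1
  rw [← dist_eq_norm]
  refine (IsUltrametricDist.dist_triangle_max _ (g d : C) _).trans_lt (max_lt h1 ?_)
  rw [dist_comm]
  exact h2

theorem exists_pow_eq (h : IsLocalSubfield k L) {p : ℕ} [Fact p.Prime] [CharP C p] (m : ℕ) {c : C}
    (hc : c ∈ k) : ∃ d ∈ k, d ^ p ^ m = c := by
  have := h.finite
  have hk : CharP k p := k.subtype.charP k.subtype.injective p
  obtain ⟨d, hd⟩ := (Finite.injective_iff_surjective.1
    (iterateFrobenius k p m).injective) ⟨c, hc⟩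
  refine ⟨d, d.2, ?_⟩
  have := congrArg Subtype.val hd
  simpa [iterateFrobenius_def] using this

/-- One step of the expansion in powers of a uniformizer `t`. -/
theorem exists_eq_add_mul (h : IsLocalSubfield k L) {t : C} (htL : t ∈ L) (ht0 : 0 < ‖t‖)
    (ht : ∀ x ∈ L, ‖x‖ < 1 → ‖x‖ ≤ ‖t‖) {x : C} (hx : x ∈ valRing L) :
    ∃ c ∈ k, ∃ y ∈ valRing L, x = c + t * y := by
  obtain ⟨c, ⟨hc, hxc⟩, -⟩ := h.residue.existsUnique x hx
  refine ⟨c, hc, (x - c) / t, ⟨?_, ?_⟩, ?_⟩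
  · exact L.div_mem (L.sub_mem hx.1 (h.residue.le hc).1) htL
  · rw [norm_div]
    exact div_le_one_of_le₀ (ht _ (L.sub_mem hx.1 (h.residue.le hc).1) hxc) (norm_nonneg _)
  · rw [mul_div_cancel₀ _ (norm_pos_iff.1 ht0)]
    ring

theorem exists_norm_eq_pow {t : C} (htL : t ∈ L) (ht0 : 0 < ‖t‖) (ht1 : ‖t‖ < 1)
    (ht : ∀ x ∈ L, ‖x‖ < 1 → ‖x‖ ≤ ‖t‖) {x : C} (hx : x ∈ valRing L) (hx0 : x ≠ 0) :
    ∃ n : ℕ, ‖x‖ = ‖t‖ ^ n := by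
  obtain ⟨n, h1, h2⟩ := exists_nat_pow_near_of_lt_one (norm_pos_iff.2 hx0) hx.2 ht0 ht1
  refine ⟨n, ?_⟩
  by_contra hne
  have h3 := ht (x / t ^ n) (L.div_mem hx.1 (L.pow_mem htL n)) (by
    rw [norm_div, norm_pow, div_lt_one (pow_pos ht0 n)]
    exact lt_of_le_of_ne h2 hne)
  rw [norm_div, norm_pow, div_le_iff₀ (pow_pos ht0 n), ← pow_succ'] at h3
  exact absurd h3 (not_le.2 h1)

theorem isNoetherianRing (h : IsLocalSubfield k L) : IsNoetherianRing (valRing L) := by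
  classical
  obtain ⟨t, htL, ht0, ht1, ht⟩ := h.exists_uniformizer
  refine (isNoetherianRing_iff_ideal_fg _).2 fun I => ?_
  by_cases hI : I = ⊥
  · rw [hI]; exact Submodule.fg_bot
  obtain ⟨x0, hx0I, hx0⟩ := Submodule.exists_mem_ne_zero_of_ne_bot hI
  have hex : ∃ n : ℕ, ∃ x ∈ I, ‖(x : C)‖ = ‖t‖ ^ n := by
    obtain ⟨n, hn⟩ := exists_norm_eq_pow htL ht0 ht1 ht x0.2 (by simpa using hx0)
    exact ⟨n, x0, hx0I, hn⟩
  obtain ⟨x, hxI, hx⟩ := Nat.find_spec hex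
  have hxC : (x : C) ≠ 0 := norm_pos_iff.1 (by rw [hx]; exact pow_pos ht0 _)
  refine ⟨{x}, le_antisymm ?_ fun y hy => ?_⟩
  · simpa [Ideal.span_le] using hxI
  · rw [Finset.coe_singleton]
    change y ∈ Ideal.span {x}
    rw [Ideal.mem_span_singleton]
    by_cases hy0 : (y : C) = 0
    · rw [show y = 0 from Subtype.ext hy0]
      exact dvd_zero _
    obtain ⟨n, hn⟩ := exists_norm_eq_pow htL ht0 ht1 ht y.2 hy0
    have hle : Nat.find hex ≤ n := Nat.find_min' hex ⟨y, hy, hn⟩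
    refine ⟨⟨y / x, L.div_mem y.2.1 x.2.1, ?_⟩, Subtype.ext ?_⟩
    · rw [norm_div, hx, hn]
      exact div_le_one_of_le₀ (pow_le_pow_of_le_one ht0.le ht1.le hle) (pow_pos ht0 _).le
    · exact (mul_div_cancel₀ _ hxC).symm

theorem isCompact_ball (h : IsLocalSubfield k L) (r : ℝ) : IsCompact {x | x ∈ L ∧ ‖x‖ ≤ r} := by
  obtain ⟨t, htL, ht0, ht1, -⟩ := h.exists_uniformizer
  obtain ⟨n, hn⟩ := pow_unbounded_of_one_lt r (one_lt_inv₀ ht0 |>.2 ht1)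
  refine (h.isCompact.image (continuous_const_mul (t ^ n)⁻¹)).of_isClosed_subset
    (h.isClosed.inter (isClosed_le continuous_norm continuous_const)) ?_
  rintro x ⟨hxL, hx⟩
  have htn : t ^ n ≠ 0 := pow_ne_zero _ (norm_pos_iff.1 ht0)
  refine ⟨t ^ n * x, ⟨L.mul_mem (L.pow_mem htL n) hxL, ?_⟩, inv_mul_cancel_left₀ htn _⟩
  rw [norm_mul, norm_pow]
  rw [inv_pow] at hn
  calc ‖t‖ ^ n * ‖x‖ ≤ ‖t‖ ^ n * (‖t‖ ^ n)⁻¹ := by gcongr; exact hx.trans hn.le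
    _ = 1 := mul_inv_cancel₀ (pow_pos ht0 n).ne'

/-! ### Norm-decreasing projections onto local fields -/

/-- A local field is spherically complete, so it is a direct summand, in the sense of normed
vector spaces, of every larger valued field. -/
theorem exists_projection (h : IsLocalSubfield k L) :
    ∃ π : C →+ C, (∀ x, π x ∈ L) ∧ (∀ x ∈ L, π x = x) ∧ (∀ a ∈ L, ∀ x, π (a * x) = a * π x) ∧
      ∀ x, ‖π x‖ ≤ ‖x‖ := by
  let S : Set (Submodule L C) := {W | ∀ m ∈ L, ∀ w ∈ W, ‖m‖ ≤ ‖m + w‖}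
  -- a maximal subspace orthogonal to `L` is a complement of `L`
  obtain ⟨W, hW⟩ : ∃ W, Maximal (· ∈ S) W := by
    refine zorn_le₀ S fun c hcS hc => ?_
    by_cases hne : c.Nonempty
    · refine ⟨sSup c, fun m hm w hw => ?_, fun W hW => le_sSup hW⟩
      obtain ⟨W, hWc, hwW⟩ := (Submodule.mem_sSup_of_directed hne hc.directedOn).1 hw
      exact hcS hWc m hm w hwW
    · rw [Set.not_nonempty_iff_eq_empty] at hne
      subst hne
      refine ⟨⊥, fun m _ w hw => ?_, by simp⟩
      rw [(Submodule.mem_bot L).1 hw, add_zero]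
  have hWS : ∀ m ∈ L, ∀ w ∈ W, ‖m‖ ≤ ‖m + w‖ := hW.1
  have hdec : ∀ x : C, ∃ m ∈ L, x - m ∈ W := by
    intro x
    -- closed balls of `L` whose common points `c` make `x - c` orthogonal to `L`
    let B : L × W → Set C := fun a =>
      {y | y ∈ L ∧ ‖(a.1 : C) + y‖ ≤ ‖x + (a.2 : C) + (a.1 : C)‖}
    have hBcl : ∀ a, IsClosed (B a) := fun a => h.isClosed.inter
      (isClosed_le (continuous_norm.comp (continuous_const.add continuous_id)) continuous_const)
    have hBsub : ∀ a b : L × W,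
        ‖x + (b.2 : C) + (b.1 : C)‖ ≤ ‖x + (a.2 : C) + (a.1 : C)‖ → -(b.1 : C) ∈ B a := by
      intro a b hab
      refine ⟨L.neg_mem b.1.2, ?_⟩
      refine (hWS _ (L.add_mem a.1.2 (L.neg_mem b.1.2)) _ (W.sub_mem a.2.2 b.2.2)).trans ?_
      rw [show (a.1 : C) + -(b.1 : C) + ((a.2 : C) - b.2) =
        (x + a.2 + a.1) - (x + b.2 + b.1) by ring]
      exact (norm_sub_le_max' _ _).trans (max_le le_rfl hab)
    classical
    have hBcpt : IsCompact (B (0, 0)) := by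
      convert h.isCompact_ball ‖x‖ using 1
      ext y
      simp [B]
    obtain ⟨m, -, hm⟩ : (B (0, 0) ∩ ⋂ a, B a).Nonempty := by
      refine hBcpt.inter_iInter_nonempty B hBcl fun u => ?_
      obtain ⟨b, -, hb⟩ := Finset.exists_min_image (insert (0, 0) u)
        (fun a : L × W => ‖x + (a.2 : C) + (a.1 : C)‖) ⟨_, Finset.mem_insert_self _ _⟩
      refine ⟨-(b.1 : C), hBsub _ _ (hb _ (Finset.mem_insert_self _ _)), Set.mem_iInter₂.2
        fun a ha => hBsub _ _ (hb _ (Finset.mem_insert_of_mem ha))⟩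
    rw [Set.mem_iInter] at hm
    have hmL : m ∈ L := (hm (0, 0)).1
    refine ⟨m, hmL, ?_⟩
    have hle : W ⊔ Submodule.span L {x - m} ∈ S := by
      rintro l hl y hy
      obtain ⟨w, hw, z, hz, rfl⟩ := Submodule.mem_sup.1 hy
      obtain ⟨a, rfl⟩ := Submodule.mem_span_singleton.1 hz
      by_cases ha : a = 0
      · subst ha
        simpa using hWS l hl w hw
      have haC : (a : C) ≠ 0 := by simpa using ha
      have h1 := (hm (⟨l / a - m, L.sub_mem (L.div_mem hl a.2) hmL⟩, a⁻¹ • ⟨w, hw⟩)).2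
      have h2 : (a : C) * (x + (a⁻¹ • (⟨w, hw⟩ : W) : W) + (l / a - m)) =
          l + (w + a • (x - m)) := by
        change (a : C) * (x + (a : C)⁻¹ * w + (l / a - m)) = l + (w + a * (x - m))
        field_simp
        ring
      rw [← h2, norm_mul]
      simp only [sub_add_cancel] at h1
      calc ‖l‖ = ‖(a : C)‖ * ‖l / a‖ := by rw [← norm_mul, mul_div_cancel₀ _ haC]
        _ ≤ _ := by gcongr
    exact hW.2 hle le_sup_left (Submodule.mem_sup_right (Submodule.mem_span_singleton_self _))
  have huniq : ∀ m ∈ L, m ∈ W → m = 0 := fun m hm hmW => by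
    have := hWS m hm (-m) (W.neg_mem hmW)
    simpa using this
  choose π hπL hπW using hdec
  have key : ∀ x m, m ∈ L → x - m ∈ W → π x = m := fun x m hm hx => by
    refine sub_eq_zero.1 (huniq _ (L.sub_mem (hπL x) hm) ?_)
    convert W.sub_mem hx (hπW x) using 1
    ring
  refine ⟨AddMonoidHom.mk' π fun x y => ?_, hπL, fun x hx => ?_, fun a ha x => ?_, fun x => ?_⟩
  · refine key _ _ (L.add_mem (hπL x) (hπL y)) ?_
    convert W.add_mem (hπW x) (hπW y) using 1
    ring
  · exact key _ _ hx (by simp)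
  · refine key _ _ (L.mul_mem ha (hπL x)) ?_
    rw [← mul_sub]
    exact W.smul_mem (⟨a, ha⟩ : L) (hπW x)
  · have := hWS _ (hπL x) _ (hπW x)
    rwa [add_sub_cancel] at this

end IsLocalSubfield

end LocalFields

/-! ### Frobenius powers of local fields -/

theorem pow_prime_pow_ne_zero {p : ℕ} [Fact p.Prime] {m : ℕ} : p ^ m ≠ 0 := (pow_pos (Fact.out : p.Prime).pos m).ne'

theorem norm_pow_le_one {C : Type*} [NormedField C] {p : ℕ} [Fact p.Prime] {m : ℕ} {x : C} : ‖x ^ p ^ m‖ ≤ 1 ↔ ‖x‖ ≤ 1 := by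
  rw [norm_pow]
  exact pow_le_one_iff_of_nonneg (norm_nonneg _) pow_prime_pow_ne_zero

theorem norm_pow_mul_lt {C : Type*} [NormedField C] {p : ℕ} [Fact p.Prime] {m : ℕ} {t : C} (ht1 : ‖t‖ < 1) {N : ℕ} {ε : ℝ} (hN : ‖t‖ ^ N < ε)
    (hNm : N ≤ m) {z : C} (hz : ‖z‖ ≤ 1) : ‖t ^ p ^ m * z‖ < ε := by
  rw [norm_mul, norm_pow]
  refine (mul_le_of_le_one_right (by positivity) hz).trans_lt (lt_of_le_of_lt ?_ hN)
  exact pow_le_pow_of_le_one (norm_nonneg _) ht1.le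
    (hNm.trans (Nat.lt_pow_self (Fact.out : p.Prime).one_lt).le)

/-- The powers `t ^ i`, `i < q`, of a uniformizer are linearly independent over the field of
`q`-th powers: the nonzero terms of the sum have different norms. -/
theorem eq_zero_of_sum_mul_pow_eq_zero {C : Type*} [NormedField C] [IsUltrametricDist C] {p : ℕ}
    [Fact p.Prime] {m : ℕ} {L : Subfield C} {t : C} (ht0 : 0 < ‖t‖)
    (ht1 : ‖t‖ < 1) (ht : ∀ x ∈ L, ‖x‖ < 1 → ‖x‖ ≤ ‖t‖) {d : Fin (p ^ m) → C}
    (hd : ∀ i, d i ∈ L) (hsum : ∑ i : Fin (p ^ m), t ^ (i : ℕ) * d i ^ p ^ m = 0) (i : Fin (p ^ m)) :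
    d i = 0 := by
  classical
  have hq : p ^ m ≠ 0 := pow_prime_pow_ne_zero
  by_contra hi
  obtain ⟨j, -, hj⟩ := Finset.exists_max_image Finset.univ (fun i => ‖d i‖) ⟨i, Finset.mem_univ i⟩
  have hdj : 0 < ‖d j‖ := (norm_pos_iff.2 hi).trans_le (hj i (Finset.mem_univ i))
  have hdj0 := norm_pos_iff.1 hdj
  -- after scaling, the largest norm is `1`
  let e : Fin (p ^ m) → C := fun i => d i / d j
  have heL : ∀ i, e i ∈ L := fun i => L.div_mem (hd i) (hd j)
  have he1 : ∀ i, ‖e i‖ ≤ 1 := fun i => by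
    rw [norm_div]
    exact div_le_one_of_le₀ (hj i (Finset.mem_univ i)) hdj.le
  have hesum : ∑ i : Fin (p ^ m), t ^ (i : ℕ) * e i ^ p ^ m = 0 := by
    have := congrArg (· / d j ^ p ^ m) hsum
    simpa [Finset.sum_div, e, div_pow, mul_div_assoc] using this
  let s := Finset.univ.filter fun i => ‖e i‖ = 1
  have hs : s.Nonempty := ⟨j, by simp [s, e, hdj0]⟩
  let i₀ := s.min' hs
  have hi₀ : ‖e i₀‖ = 1 := (Finset.mem_filter.1 (s.min'_mem hs)).2
  have hlt : ∀ i ∈ Finset.univ.erase i₀, ‖t ^ (i : ℕ) * e i ^ p ^ m‖ ≤ ‖t‖ ^ ((i₀ : ℕ) + 1) := by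
    intro i hi
    have hne := Finset.ne_of_mem_erase hi
    rw [norm_mul, norm_pow, norm_pow]
    rcases lt_or_gt_of_ne hne with hlt | hgt
    · have h1 : ‖e i‖ < 1 := lt_of_le_of_ne (he1 i) fun h =>
        absurd (s.min'_le i (by simp [s, h])) (not_le.2 hlt)
      calc ‖t‖ ^ (i : ℕ) * ‖e i‖ ^ p ^ m ≤ 1 * ‖t‖ ^ p ^ m := by
            gcongr
            · exact pow_le_one₀ ht0.le ht1.le
            · exact ht _ (heL i) h1
        _ ≤ ‖t‖ ^ ((i₀ : ℕ) + 1) := by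
            rw [one_mul]
            exact pow_le_pow_of_le_one ht0.le ht1.le i₀.2
    · calc ‖t‖ ^ (i : ℕ) * ‖e i‖ ^ p ^ m ≤ ‖t‖ ^ (i : ℕ) * 1 := by
            gcongr
            exact pow_le_one₀ (norm_nonneg _) (he1 i)
        _ ≤ ‖t‖ ^ ((i₀ : ℕ) + 1) := by
            rw [mul_one]
            exact pow_le_pow_of_le_one ht0.le ht1.le hgt
  rw [← Finset.add_sum_erase _ _ (Finset.mem_univ i₀)] at hesum
  have h1 := IsUltrametricDist.norm_sum_le_of_forall_le_of_nonneg
    (pow_nonneg ht0.le ((i₀ : ℕ) + 1)) hlt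
  rw [← norm_neg, ← eq_neg_of_add_eq_zero_left hesum, norm_mul, norm_pow, norm_pow, hi₀,
    one_pow, mul_one] at h1
  exact absurd (pow_lt_pow_right_of_lt_one₀ ht0 ht1 (Nat.lt_succ_self (i₀ : ℕ))) (not_lt.2 h1)

section Frobenius

variable {C : Type*} [NormedField C] (p : ℕ) [Fact p.Prime] [CharP C p] (m : ℕ)

/-- The field of `p ^ m`-th roots, inside `C`, of the elements of `L`. -/
def rootField (L : Subfield C) : Subfield C := L.comap (iterateFrobenius C p m)

/-- The field of `p ^ m`-th powers of the elements of `L`. -/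
def powField (L : Subfield C) : Subfield C := L.map (iterateFrobenius C p m)

variable {p m}

theorem mem_rootField {L : Subfield C} {x : C} : x ∈ rootField p m L ↔ x ^ p ^ m ∈ L := Iff.rfl

theorem mem_powField {L : Subfield C} {x : C} :
    x ∈ powField p m L ↔ ∃ y ∈ L, y ^ p ^ m = x := Iff.rfl

theorem le_rootField (L : Subfield C) : L ≤ rootField p m L := fun _ hx => L.pow_mem hx _

theorem powField_le (L : Subfield C) : powField p m L ≤ L := by
  rintro _ ⟨y, hy, rfl⟩
  exact L.pow_mem hy _

theorem powField_rootField [IsAlgClosed C] (L : Subfield C) :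
    powField p m (rootField p m L) = L := by
  ext x
  refine ⟨fun ⟨y, hy, hyx⟩ => hyx ▸ hy, fun hx => ?_⟩
  obtain ⟨y, hy⟩ := IsAlgClosed.exists_pow_nat_eq x (pow_pos (Fact.out : p.Prime).pos m)
  exact ⟨y, show y ^ p ^ m ∈ L from hy ▸ hx, hy⟩

theorem norm_sub_pow (x y : C) : ‖x - y‖ ^ p ^ m = ‖x ^ p ^ m - y ^ p ^ m‖ := by
  rw [← norm_pow, sub_pow_expChar_pow]

theorem continuous_root {ρ : C → C} (hρ : ∀ x, ρ x ^ p ^ m = x) : Continuous ρ := by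
  refine Metric.continuous_iff.2 fun x ε hε => ⟨ε ^ p ^ m, pow_pos hε _, fun y hy => ?_⟩
  rw [dist_eq_norm] at hy ⊢
  refine lt_of_pow_lt_pow_left₀ (p ^ m) hε.le ?_
  rwa [norm_sub_pow, hρ, hρ]

variable {L : Subfield C}

theorem rootField_mono {m m' : ℕ} (h : m ≤ m') (L : Subfield C) :
    rootField p m L ≤ rootField p m' L := by
  intro x hx
  rw [mem_rootField] at hx ⊢
  rw [← Nat.add_sub_cancel' h, pow_add, pow_mul]
  exact L.pow_mem hx _

theorem mem_perf_iff {x : C} : x ∈ perf L ↔ ∃ m, x ∈ rootField p m L := by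
  have : CharP L p := L.subtype.charP L.subtype.injective p
  change x ∈ perfectClosure L C ↔ _
  rw [mem_perfectClosure_iff_pow_mem p]
  refine exists_congr fun m => ?_
  rw [mem_rootField]
  exact ⟨fun ⟨y, hy⟩ => hy ▸ y.2, fun h => ⟨⟨_, h⟩, rfl⟩⟩

theorem rootField_le_perfHat (L : Subfield C) : rootField p m L ≤ perfHat L := fun _ hx =>
  Subfield.le_topologicalClosure _ (mem_perf_iff.2 ⟨m, hx⟩)

variable [IsUltrametricDist C]

theorem coe_valRing_powField (L : Subfield C) :
    (valRing (powField p m L) : Set C) = (fun x => x ^ p ^ m) '' (valRing L : Set C) := by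
  ext x
  constructor
  · rintro ⟨⟨y, hy, rfl⟩, hx⟩
    exact ⟨y, ⟨hy, norm_pow_le_one.1 hx⟩, rfl⟩
  · rintro ⟨y, hy, rfl⟩
    exact ⟨⟨y, hy.1, rfl⟩, norm_pow_le_one.2 hy.2⟩

namespace IsLocalSubfield

variable {k : Subfield C}

theorem isClosed_valRing_powField (h : IsLocalSubfield k L) :
    IsClosed (valRing (powField p m L) : Set C) := by
  rw [coe_valRing_powField]
  exact (h.isCompact.image (continuous_pow _)).isClosed

theorem le_valRing_powField (h : IsLocalSubfield k L) {c : C} (hc : c ∈ k) :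
    c ∈ valRing (powField p m L) := by
  obtain ⟨d, hd, hdc⟩ := h.exists_pow_eq (p := p) m hc
  exact ⟨⟨d, (h.residue.le hd).1, hdc⟩, (h.residue.le hc).2⟩

theorem toRootField [IsAlgClosed C] (h : IsLocalSubfield k L) :
    IsLocalSubfield k (rootField p m L) := by
  have hq : p ^ m ≠ 0 := pow_prime_pow_ne_zero
  have hex : ∀ x : C, ∃ y : C, y ^ p ^ m = x := fun x =>
    IsAlgClosed.exists_pow_nat_eq x (Nat.pos_of_ne_zero hq)
  choose ρ hρ using hex
  have hinv : ∀ x, ρ (x ^ p ^ m) = x := fun x => (iterateFrobenius C p m).injective (hρ _)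
  refine ⟨⟨fun c hc => ⟨le_rootField L (h.residue.le hc).1, (h.residue.le hc).2⟩,
    fun x hx => ?_⟩, ?_, ?_⟩
  · obtain ⟨c, ⟨hc, hxc⟩, -⟩ := h.residue.existsUnique (x ^ p ^ m)
      ⟨hx.1, norm_pow_le_one.2 hx.2⟩
    obtain ⟨d, hd, rfl⟩ := h.exists_pow_eq (p := p) m hc
    rw [← norm_sub_pow, pow_lt_one_iff_of_nonneg (norm_nonneg _) hq] at hxc
    refine ⟨d, ⟨hd, hxc⟩, fun e ⟨he, hxe⟩ => h.residue.eq_of_norm_sub_lt he hd ?_⟩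
    rw [show e - d = (x - d) - (x - e) by ring]
    exact (norm_sub_le_max' _ _).trans_lt (max_lt hxc hxe)
  · refine (h.isCompact.image (continuous_root hρ)).of_isClosed_subset ?_ ?_
    · refine (h.isClosed.preimage (continuous_pow (p ^ m))).inter
        (isClosed_le continuous_norm continuous_const)
    · exact fun x hx => ⟨x ^ p ^ m, ⟨hx.1, norm_pow_le_one.2 hx.2⟩, hinv x⟩
  · obtain ⟨t, htL, ht0, ht1, ht⟩ := h.exists_uniformizer
    refine ⟨ρ t, ?_, ?_, ?_, fun x hx hx1 => ?_⟩
    · rwa [mem_rootField, hρ]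
    · rw [norm_pos_iff, Ne, ← pow_eq_zero_iff hq, hρ, ← Ne, ← norm_pos_iff]
      exact ht0
    · rw [← pow_lt_one_iff_of_nonneg (norm_nonneg _) hq, ← norm_pow, hρ]
      exact ht1
    · rw [← pow_le_pow_iff_left₀ (norm_nonneg _) (norm_nonneg _) hq, ← norm_pow, ← norm_pow, hρ]
      refine ht _ hx ?_
      rw [norm_pow]
      exact pow_lt_one₀ (norm_nonneg _) hx1 hq

/-- Every integer `x` of a local field is a sum `∑ i < q, t ^ i * d i ^ q`, where `q = p ^ m` and
`t` is a uniformizer. -/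
theorem exists_eq_sum (h : IsLocalSubfield k L) {t : C} (htL : t ∈ L) (ht0 : 0 < ‖t‖)
    (ht1 : ‖t‖ < 1) (ht : ∀ x ∈ L, ‖x‖ < 1 → ‖x‖ ≤ ‖t‖) {x : C} (hx : x ∈ valRing L) :
    ∃ d : Fin (p ^ m) → C, (∀ i, d i ∈ valRing L) ∧
      x = ∑ i : Fin (p ^ m), t ^ (i : ℕ) * d i ^ p ^ m := by
  have hq : 0 < p ^ m := Nat.pos_of_ne_zero pow_prime_pow_ne_zero
  -- these sums form a compact set, which contains the products `t ^ j * c` with `c` in `k`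
  let D : Set C := (fun d : Fin (p ^ m) → C => ∑ i : Fin (p ^ m), t ^ (i : ℕ) * d i ^ p ^ m) ''
    Set.univ.pi fun _ => (valRing L : Set C)
  have hD : IsClosed D := (IsCompact.image (isCompact_univ_pi fun _ => h.isCompact)
    (by fun_prop)).isClosed
  have htR : t ∈ valRing L := ⟨htL, ht1.le⟩
  have hDadd : ∀ a ∈ D, ∀ b ∈ D, a + b ∈ D := by
    rintro _ ⟨d, hd, rfl⟩ _ ⟨e, he, rfl⟩
    refine ⟨d + e, fun i hi => (valRing L).add_mem (hd i hi) (he i hi), ?_⟩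
    simp only [Pi.add_apply, add_pow_expChar_pow, mul_add, Finset.sum_add_distrib]
  have hDmon : ∀ (j : ℕ), ∀ c ∈ k, t ^ j * c ∈ D := by
    intro j c hc
    obtain ⟨d, hd, rfl⟩ := h.exists_pow_eq (p := p) m hc
    refine ⟨Pi.single ⟨j % p ^ m, Nat.mod_lt _ hq⟩ (t ^ (j / p ^ m) * d), fun i _ => ?_, ?_⟩
    · by_cases hi : i = ⟨j % p ^ m, Nat.mod_lt _ hq⟩
      · subst hi
        rw [Pi.single_eq_same]
        exact (valRing L).mul_mem ((valRing L).pow_mem htR _) (h.residue.le hd)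
      · rw [Pi.single_eq_of_ne hi]
        exact (valRing L).zero_mem
    · simp only
      rw [Finset.sum_eq_single ⟨j % p ^ m, Nat.mod_lt _ hq⟩]
      · rw [Pi.single_eq_same, mul_pow, ← mul_assoc, ← pow_mul, ← pow_add]
        congr 2
        rw [mul_comm]
        exact Nat.mod_add_div j _
      · intro i _ hi
        rw [Pi.single_eq_of_ne hi, zero_pow hq.ne', mul_zero]
      · simp
  have happrox : ∀ N : ℕ, ∃ y ∈ D, ∃ z ∈ valRing L, x = y + t ^ N * z := by
    intro N
    induction N with
    | zero => exact ⟨0, by simpa using hDmon 0 0 k.zero_mem, x, hx, by simp⟩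
    | succ N ih =>
      obtain ⟨y, hy, z, hz, rfl⟩ := ih
      obtain ⟨c, hc, z', hz', rfl⟩ := h.exists_eq_add_mul htL ht0 ht hz
      exact ⟨y + t ^ N * c, hDadd _ hy _ (hDmon N c hc), z', hz', by ring⟩
  have hxD : x ∈ D := by
    rw [← hD.closure_eq]
    refine Metric.mem_closure_iff.2 fun ε hε => ?_
    obtain ⟨N, hN⟩ := exists_pow_lt_of_lt_one hε ht1
    obtain ⟨y, hy, z, hz, hxy⟩ := happrox N
    refine ⟨y, hy, ?_⟩
    rw [dist_eq_norm, hxy, add_sub_cancel_left, norm_mul, norm_pow]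
    exact (mul_le_of_le_one_right (by positivity) hz.2).trans_lt hN
  obtain ⟨d, hd, hdx⟩ := hxD
  exact ⟨d, fun i => hd i trivial, hdx.symm⟩

/-- A `p ^ m`-th power in the valuation ring of `L` is congruent to an element of `k` modulo
`t ^ p ^ m`. -/
theorem exists_eq_add_pow_mul (h : IsLocalSubfield k L) {t : C} (htL : t ∈ L) (ht0 : 0 < ‖t‖)
    (ht : ∀ x ∈ L, ‖x‖ < 1 → ‖x‖ ≤ ‖t‖) {x : C} (hx : x ∈ valRing (powField p m L)) :
    ∃ c ∈ k, ∃ y ∈ valRing L, x = c + t ^ p ^ m * y := by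
  rw [← SetLike.mem_coe, coe_valRing_powField] at hx
  obtain ⟨y, hy, rfl⟩ := hx
  obtain ⟨c, hc, z, hz, rfl⟩ := h.exists_eq_add_mul htL ht0 ht hy
  exact ⟨c ^ p ^ m, k.pow_mem hc _, z ^ p ^ m, (valRing L).pow_mem hz _, by
    rw [← mul_pow, ← add_pow_expChar_pow]⟩

end IsLocalSubfield

end Frobenius

open CommFormalGroup

/-! ### Ideals of power series vanishing on a set of points -/

section Vanishing

variable {C : Type*} [NormedField C] [IsUltrametricDist C]

theorem continuous_inclusion {L M : Subfield C} (h : L ≤ M) : Continuous (inclusion h) :=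
  Continuous.subtype_mk continuous_subtype_val _

@[simp]
theorem coe_inclusion {L M : Subfield C} (h : L ≤ M) (x : valRing L) :
    (inclusion h x : C) = x := rfl

theorem inclusion_injective {L M : Subfield C} (h : L ≤ M) : Function.Injective (inclusion h) :=
  fun _ _ hxy => Subtype.ext (congrArg (fun z : valRing M => (z : C)) hxy)

theorem continuous_map {A B : Type*} [CommRing A] [CommRing B] [TopologicalSpace A]
    [TopologicalSpace B] {σ : Type*} {φ : A →+* B} (hφ : Continuous φ) :
    Continuous (MvPowerSeries.map φ : MvPowerSeries σ A → MvPowerSeries σ B) :=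
  continuous_pi fun d => hφ.comp (WithPiTopology.continuous_coeff A d)

theorem mem_closure_of_forall_exists {M : Subfield C} {σ : Type*}
    {S : Set (MvPowerSeries σ (valRing M))} {f : MvPowerSeries σ (valRing M)}
    (h : ∀ (F : Finset (σ →₀ ℕ)) (ε : ℝ), 0 < ε →
      ∃ g ∈ S, ∀ d ∈ F, ‖(coeff d f).1 - (coeff d g).1‖ < ε) : f ∈ closure S := by
  rw [mem_closure_iff]
  intro o ho hfo
  obtain ⟨F, u, hu, huo⟩ := isOpen_pi_iff.1 ho f hfo
  have hball : ∀ d : F, ∃ ε > 0, Metric.ball (coeff d.1 f) ε ⊆ u d := fun d =>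
    Metric.isOpen_iff.1 (hu d d.2).1 _ (hu d d.2).2
  choose ε hε hεu using hball
  obtain ⟨δ, hδ, hδε⟩ : ∃ δ > 0, ∀ d, δ ≤ ε d := by
    have : ∀ᶠ δ in nhdsWithin (0 : ℝ) (Set.Ioi 0), 0 < δ ∧ ∀ d, δ ≤ ε d :=
      eventually_mem_nhdsWithin.and
        (Filter.eventually_all.2 fun d => nhdsWithin_le_nhds (Iic_mem_nhds (hε d)))
    exact this.exists
  obtain ⟨g, hg, hgF⟩ := h F δ hδ
  refine ⟨g, huo fun d hd => hεu ⟨d, hd⟩ ?_, hg⟩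
  rw [Metric.mem_ball, dist_comm]
  change dist (coeff d f).1 (coeff d g).1 < _
  rw [dist_eq_norm]
  exact (hgF d hd).trans_le (hδε ⟨d, hd⟩)

section Rational

variable {n : ℕ} {H : CommFormalGroup (valRing (⊤ : Subfield C)) n}

/-- The value at `v` of the monomial with exponent `d`. -/
def monomialValue (v : H.Points) (d : Fin n →₀ ℕ) : C := d.prod fun i e => (v.coord i : C) ^ e

/-- The point `v` has coordinates in `L`. -/
def IsRational (L : Subfield C) (v : H.Points) : Prop := ∀ i, (v.coord i : C) ∈ L

theorem IsRational.mono {L M : Subfield C} (h : L ≤ M) {v : H.Points} (hv : IsRational L v) :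
    IsRational M v := fun i => h (hv i)

theorem IsRational.monomialValue_mem {L : Subfield C} {v : H.Points} (hv : IsRational L v)
    (d : Fin n →₀ ℕ) : monomialValue v d ∈ L :=
  L.toSubring.prod_mem fun i _ => L.pow_mem (hv i) _

theorem IsRational.monomialValue_mem_valRing {L : Subfield C} {v : H.Points} (hv : IsRational L v)
    (d : Fin n →₀ ℕ) : monomialValue v d ∈ valRing L :=
  (valRing L).prod_mem fun i _ => (valRing L).pow_mem ⟨hv i, (v.coord i).2.2⟩ _

end Rational

variable [CompleteSpace C]

instance : CompleteSpace (⊤ : Subfield C) :=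
  (isClosed_univ : IsClosed ((⊤ : Subfield C) : Set C)).completeSpace_coe

variable {n : ℕ} {H : CommFormalGroup (valRing (⊤ : Subfield C)) n}

/-- The ideal of power series over the valuation ring of `M` that vanish on a set `T` of points.
The coordinates of the points of `T` may be arbitrary elements of `C` of norm less than `1`. -/
def vanishing (M : Subfield C) (T : Set H.Points) :
    Ideal (MvPowerSeries (Fin n) (valRing M)) where
  carrier := {f | ∀ v ∈ T, aeval (R := valRing (⊤ : Subfield C)) v.hasEval
    (MvPowerSeries.map (inclusion le_top) f) = 0}
  add_mem' ha hb v hv := by rw [map_add, map_add, ha v hv, hb v hv, add_zero]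
  zero_mem' v _ := by rw [map_zero, map_zero]
  smul_mem' c f hf v hv := by rw [smul_eq_mul, map_mul, map_mul, hf v hv, mul_zero]

theorem mem_vanishing {M : Subfield C} {T : Set H.Points}
    {f : MvPowerSeries (Fin n) (valRing M)} : f ∈ vanishing M T ↔ ∀ v ∈ T,
      aeval (R := valRing (⊤ : Subfield C)) v.hasEval
        (MvPowerSeries.map (inclusion le_top) f) = 0 := Iff.rfl

theorem hasSum_aeval_map {M : Subfield C} (v : H.Points) (f : MvPowerSeries (Fin n) (valRing M)) :
    HasSum (fun d => (coeff d f).1 * monomialValue v d)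
      (aeval (R := valRing (⊤ : Subfield C)) v.hasEval
        (MvPowerSeries.map (inclusion le_top) f) : C) := by
  have h := (hasSum_aeval (R := valRing (⊤ : Subfield C)) v.hasEval
    (MvPowerSeries.map (inclusion le_top) f)).map (valRing (⊤ : Subfield C)).subtype
    continuous_subtype_val
  convert! h using 2 with d
  rw [Function.comp_apply, smul_eq_mul, map_mul, Finsupp.prod, map_prod, coeff_map, monomialValue,
    Finsupp.prod]
  simp

theorem mem_vanishing_iff_hasSum {M : Subfield C} {T : Set H.Points}
    {f : MvPowerSeries (Fin n) (valRing M)} : f ∈ vanishing M T ↔ ∀ v ∈ T,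
      HasSum (fun d => (coeff d f).1 * monomialValue v d) 0 := by
  refine forall₂_congr fun v _ => ⟨fun h => ?_, fun h => ?_⟩
  · simpa [h] using hasSum_aeval_map v f
  · exact Subtype.ext ((hasSum_aeval_map v f).unique h)

theorem map_mem_vanishing_iff {M M' : Subfield C} (h : M ≤ M') {T : Set H.Points}
    {f : MvPowerSeries (Fin n) (valRing M)} :
    MvPowerSeries.map (inclusion h) f ∈ vanishing M' T ↔ f ∈ vanishing M T := by
  rw [mem_vanishing_iff_hasSum, mem_vanishing_iff_hasSum]
  simp only [coeff_map, coe_inclusion]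

theorem isClosed_vanishing (M : Subfield C) (T : Set H.Points) :
    IsClosed (vanishing M T : Set (MvPowerSeries (Fin n) (valRing M))) := by
  have : (vanishing M T : Set (MvPowerSeries (Fin n) (valRing M))) =
      ⋂ v ∈ T, {f | aeval (R := valRing (⊤ : Subfield C)) v.hasEval
        (MvPowerSeries.map (inclusion le_top) f) = 0} := by
    ext f
    simp [mem_vanishing]
  rw [this]
  exact isClosed_biInter fun v _ => isClosed_eq ((continuous_aeval v.hasEval).comp
    (continuous_map (continuous_inclusion le_top))) continuous_const

theorem vanishing_anti (M : Subfield C) {S T : Set H.Points} (h : S ⊆ T) :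
    vanishing M T ≤ vanishing M S := fun _ hf v hv => hf v (h hv)

theorem vanishing_iUnion (M : Subfield C) {ι : Type*} (T : ι → Set H.Points) :
    vanishing M (⋃ i, T i) = ⨅ i, vanishing M (T i) := by
  ext f
  simp only [Ideal.mem_iInf, mem_vanishing, Set.mem_iUnion]
  exact ⟨fun h i v hv => h v ⟨i, hv⟩, fun h v ⟨i, hv⟩ => h i v hv⟩

/-- The closed formal subscheme cut out by the power series that vanish on `T`. -/
def zariskiClosure (M : Subfield C) (T : Set H.Points) :
    ClosedFormalSubscheme (valRing M) n where
  ideal := vanishing M T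
  isClosed := isClosed_vanishing M T

theorem map_vanishing_le {M M' : Subfield C} (h : M ≤ M') (T : Set H.Points) :
    (vanishing M T).map (MvPowerSeries.map (inclusion h)) ≤ vanishing M' T :=
  Ideal.map_le_iff_le_comap.2 fun _ hf => (map_mem_vanishing_iff h).2 hf

/-! ### Power series vanishing on points over the subfield of `p ^ m`-th powers -/

variable {p : ℕ} [Fact p.Prime] [CharP C p] {m : ℕ} {k L : Subfield C}

namespace IsLocalSubfield

/-- If the points of `T` have coordinates in the field `N` of `p ^ m`-th powers of `L`, then
the power series over `L` that vanish on `T` are combinations, with the powers of a uniformizer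
as coefficients, of power series over `N` that vanish on `T`. -/
theorem exists_coeff_eq_sum (h : IsLocalSubfield k L) {t : C} (htL : t ∈ L) (ht0 : 0 < ‖t‖)
    (ht1 : ‖t‖ < 1) (ht : ∀ x ∈ L, ‖x‖ < 1 → ‖x‖ ≤ ‖t‖) {N : Subfield C}
    (hN : N = powField p m L) {T : Set H.Points} (hT : ∀ v ∈ T, IsRational N v)
    {f : MvPowerSeries (Fin n) (valRing L)} (hf : f ∈ vanishing L T) :
    ∃ g : Fin (p ^ m) → MvPowerSeries (Fin n) (valRing N), (∀ i, g i ∈ vanishing N T) ∧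
      ∀ d, (coeff d f).1 = ∑ i : Fin (p ^ m), t ^ (i : ℕ) * (coeff d (g i)).1 := by
  subst hN
  have hex := fun d => h.exists_eq_sum (p := p) (m := m) htL ht0 ht1 ht (coeff d f).2
  choose e he hfe using hex
  let g : Fin (p ^ m) → MvPowerSeries (Fin n) (valRing (powField p m L)) := fun i d =>
    ⟨e d i ^ p ^ m, ⟨e d i, (he d i).1, rfl⟩, norm_pow_le_one.2 (he d i).2⟩
  have hg : ∀ i d, (coeff d (g i)).1 = e d i ^ p ^ m := fun i d => rfl
  refine ⟨g, fun i => mem_vanishing.2 fun v hv => ?_, fun d => by simp only [hg]; exact hfe d⟩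
  let s : Fin (p ^ m) → C := fun i => (aeval (R := valRing (⊤ : Subfield C)) v.hasEval
    (MvPowerSeries.map (inclusion le_top) (g i)) : valRing (⊤ : Subfield C))
  have hs : ∀ i, HasSum (fun d => (coeff d (g i)).1 * monomialValue v d) (s i) := fun i =>
    hasSum_aeval_map v (g i)
  have hsmem : ∀ i, s i ∈ valRing (powField p m L) := fun i =>
    h.isClosed_valRing_powField.mem_of_tendsto (hs i) (Filter.Eventually.of_forall fun F =>
      (valRing (powField p m L)).sum_mem fun d _ => (valRing (powField p m L)).mul_mem
        (coeff d (g i)).2 ((hT v hv).monomialValue_mem_valRing d))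
  have hsum : ∑ i : Fin (p ^ m), t ^ (i : ℕ) * s i = 0 := by
    refine HasSum.unique ?_ (mem_vanishing_iff_hasSum.1 hf v hv)
    convert! hasSum_sum fun (i : Fin (p ^ m)) (_ : i ∈ Finset.univ) =>
      (hs i).mul_left (t ^ (i : ℕ)) using 2 with d
    rw [hfe, Finset.sum_mul]
    refine Finset.sum_congr rfl fun i _ => ?_
    rw [hg, mul_assoc]
  choose y hy hys using fun i => mem_powField.1 (hsmem i).1
  simp only [← hys] at hsum
  have := eq_zero_of_sum_mul_pow_eq_zero ht0 ht1 ht hy hsum i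
  refine Subtype.ext ?_
  change s i = 0
  rw [← hys, this, zero_pow pow_prime_pow_ne_zero]

end IsLocalSubfield

end Vanishing

/-! ### Descent from the perfection and to the residue field -/

section Descent

variable {C : Type*} [NormedField C] [IsUltrametricDist C] [CompleteSpace C]
  {p : ℕ} [Fact p.Prime] [CharP C p] {m : ℕ} {k L : Subfield C}
  {n : ℕ} {H : CommFormalGroup (valRing (⊤ : Subfield C)) n}

namespace IsLocalSubfield

/-- Over the completed perfection of `L`, the power series that vanish on a set of points with
coordinates in `L` are topologically generated by those with coefficients in `L`. -/
theorem vanishing_perfHat_le [IsAlgClosed C] (h : IsLocalSubfield k L) (p : ℕ) [Fact p.Prime]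
    [CharP C p] {T : Set H.Points} (hT : ∀ v ∈ T, IsRational L v) (hL : L ≤ perfHat L) :
    (vanishing (perfHat L) T : Set (MvPowerSeries (Fin n) (valRing (perfHat L)))) ⊆
      closure ((vanishing L T).map (MvPowerSeries.map (inclusion hL))) := by
  intro f hf
  refine mem_closure_of_forall_exists fun F ε hε => ?_
  -- approximate the relevant coefficients by elements of a field `M` of `p ^ m`-th roots
  obtain ⟨m, hm⟩ : ∃ m, ∀ d ∈ F, ∃ y ∈ FormalML.rootField p m L, ‖(coeff d f).1 - y‖ < ε := by
    have hex : ∀ d, ∃ m, ∃ y ∈ FormalML.rootField p m L, ‖(coeff d f).1 - y‖ < ε := by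
      intro d
      obtain ⟨y, hy, hyd⟩ := Metric.mem_closure_iff.1 (coeff d f).2.1 ε hε
      obtain ⟨m, hm⟩ := (mem_perf_iff (p := p)).1 hy
      exact ⟨m, y, hm, by rwa [← dist_eq_norm]⟩
    choose μ y hy hyd using hex
    exact ⟨F.sup μ, fun d hd => ⟨y d, rootField_mono (Finset.le_sup hd) L (hy d), hyd d⟩⟩
  have hM := h.toRootField (p := p) (m := m)
  set M := FormalML.rootField p m L with hMdef
  obtain ⟨t, htM, ht0, ht1, ht⟩ := hM.exists_uniformizer
  obtain ⟨π, hπM, hπid, hπmul, hπnorm⟩ := hM.exists_projection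
  have hπcont : Continuous π := AddMonoidHomClass.continuous_of_bound π 1 fun x => by
    rw [one_mul]
    exact hπnorm x
  -- `π` is linear over `L`, which contains the values of the monomials at the points of `T`
  let f' : MvPowerSeries (Fin n) (valRing M) := fun d =>
    ⟨π (coeff d f).1, hπM _, (hπnorm _).trans (coeff d f).2.2⟩
  have hcf' : ∀ d, (coeff d f').1 = π (coeff d f).1 := fun d => rfl
  have hf' : f' ∈ vanishing M T := by
    refine mem_vanishing_iff_hasSum.2 fun v hv => ?_
    have := (mem_vanishing_iff_hasSum.1 hf v hv).map π hπcont
    rw [map_zero] at this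
    convert! this using 2 with d
    rw [Function.comp_apply, hcf', mul_comm, mul_comm _ (monomialValue v d), hπmul]
    exact le_rootField L ((hT v hv).monomialValue_mem d)
  obtain ⟨g, hg, hfg⟩ := hM.exists_coeff_eq_sum (p := p) (m := m) htM ht0 ht1 ht (N := L)
    (powField_rootField L).symm hT hf'
  have htR : t ∈ valRing (perfHat L) := ⟨rootField_le_perfHat L htM, ht1.le⟩
  refine ⟨∑ i : Fin (p ^ m), MvPowerSeries.C ((⟨t, htR⟩ : valRing (perfHat L)) ^ (i : ℕ)) *
    MvPowerSeries.map (inclusion hL) (g i), ?_, fun d hd => ?_⟩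
  · exact Ideal.sum_mem _ fun i _ => Ideal.mul_mem_left _ _ (Ideal.mem_map_of_mem _ (hg i))
  · obtain ⟨y, hy, hyd⟩ := hm d hd
    have : (coeff d (∑ i : Fin (p ^ m), MvPowerSeries.C ((⟨t, htR⟩ : valRing (perfHat L)) ^
        (i : ℕ)) * MvPowerSeries.map (inclusion hL) (g i))).1 = π (coeff d f).1 := by
      rw [← hcf', hfg, map_sum]
      simp only [coeff_C_mul, coeff_map]
      exact map_sum (valRing (perfHat L)).subtype _ _
    rw [this]
    rw [show (coeff d f).1 - π (coeff d f).1 =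
      ((coeff d f).1 - y) - π ((coeff d f).1 - y) by rw [map_sub, hπid y hy]; ring]
    exact (norm_sub_le_max' _ _).trans_lt (max_lt hyd ((hπnorm _).trans_lt hyd))

/-- An ideal `J` of power series over `L` is topologically generated by power series over `k` if,
for all large `m`, it is the ideal of a set of points with coordinates in the field of `p ^ m`-th
powers. -/
theorem le_closure_map_comap (h : IsLocalSubfield k L)
    {J : Ideal (MvPowerSeries (Fin n) (valRing L))} {m₀ : ℕ}
    (hJ : ∀ m, m₀ ≤ m → ∃ T : Set H.Points, (∀ v ∈ T, IsRational (powField p m L) v) ∧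
      J = vanishing L T) :
    (J : Set (MvPowerSeries (Fin n) (valRing L))) ⊆ closure
      ((J.comap (MvPowerSeries.map (h.residue.inclusion le_rfl))).map
        (MvPowerSeries.map (h.residue.inclusion le_rfl))) := by
  obtain ⟨t, htL, ht0, ht1, ht⟩ := h.exists_uniformizer
  have hJcl : IsClosed (J : Set (MvPowerSeries (Fin n) (valRing L))) := by
    obtain ⟨T, -, rfl⟩ := hJ m₀ le_rfl
    exact isClosed_vanishing L T
  -- `J` has generators over the field of `p ^ m`-th powers, which are constant modulo `t ^ p ^ m`
  have key : ∀ ε > 0, ∃ (m : ℕ), (∀ z ∈ valRing L, ‖t ^ p ^ m * z‖ < ε) ∧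
      ∀ f ∈ J, ∃ g : Fin (p ^ m) → MvPowerSeries (Fin n) (valRing L), (∀ i, g i ∈ J) ∧
      (∀ d, (coeff d f).1 = ∑ i : Fin (p ^ m), t ^ (i : ℕ) * (coeff d (g i)).1) ∧
      ∀ i d, ∃ c ∈ k, ∃ y ∈ valRing L, (coeff d (g i)).1 = c + t ^ p ^ m * y := by
    intro ε hε
    obtain ⟨N, hN⟩ := exists_pow_lt_of_lt_one hε ht1
    refine ⟨max N m₀, fun z hz => norm_pow_mul_lt ht1 hN (le_max_left _ _) hz.2, fun f hf => ?_⟩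
    obtain ⟨T, hT, rfl⟩ := hJ (max N m₀) (le_max_right _ _)
    obtain ⟨g, hg, hfg⟩ := h.exists_coeff_eq_sum htL ht0 ht1 ht rfl hT hf
    exact ⟨fun i => MvPowerSeries.map (inclusion (powField_le L)) (g i),
      fun i => (map_mem_vanishing_iff _).2 (hg i), hfg,
      fun i d => h.exists_eq_add_pow_mul htL ht0 ht (coeff d (g i)).2⟩
  -- the reduction of an element of `J` lies in `J`
  have hred : ∀ f ∈ J, ∀ c : MvPowerSeries (Fin n) k,
      (∀ d, ‖(coeff d f).1 - (coeff d c).1‖ < 1) →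
      MvPowerSeries.map (h.residue.inclusion le_rfl) c ∈ J := by
    intro f hf c hc
    rw [← SetLike.mem_coe, ← hJcl.closure_eq]
    refine mem_closure_of_forall_exists fun F ε hε => ?_
    obtain ⟨m, hm, hdec⟩ := key (min ε 1) (lt_min hε one_pos)
    obtain ⟨g, hg, hfg, hgc⟩ := hdec f hf
    have hq : 0 < p ^ m := Nat.pos_of_ne_zero pow_prime_pow_ne_zero
    let i₀ : Fin (p ^ m) := ⟨0, hq⟩
    refine ⟨g i₀, hg i₀, fun d _ => ?_⟩
    obtain ⟨e, he, y, hy, hgy⟩ := hgc i₀ d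
    have h1 : ‖(coeff d f).1 - (coeff d (g i₀)).1‖ < 1 := by
      rw [hfg, ← Finset.add_sum_erase _ _ (Finset.mem_univ i₀), pow_zero, one_mul,
        add_sub_cancel_left]
      refine lt_of_le_of_lt (IsUltrametricDist.norm_sum_le_of_forall_le_of_nonneg
        (norm_nonneg t) fun i hi => ?_) ht1
      have hi0 : (i : ℕ) ≠ 0 := fun h0 => Finset.ne_of_mem_erase hi (Fin.ext h0)
      rw [norm_mul, norm_pow]
      calc ‖t‖ ^ (i : ℕ) * ‖(coeff d (g i)).1‖ ≤ ‖t‖ ^ (i : ℕ) * 1 := by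
            gcongr
            exact (coeff d (g i)).2.2
        _ ≤ ‖t‖ := by
            rw [mul_one]
            exact pow_le_of_le_one ht0.le ht1.le hi0
    have h2 := hm y hy
    have h3 : e = (coeff d c).1 := by
      refine h.residue.eq_of_norm_sub_lt he (coeff d c).2 ?_
      rw [show e - (coeff d c).1 = ((coeff d f).1 - (coeff d c).1) -
        (((coeff d f).1 - (coeff d (g i₀)).1) + t ^ p ^ m * y) by rw [hgy]; ring]
      refine (norm_sub_le_max' _ _).trans_lt (max_lt (hc d) ?_)
      exact (IsUltrametricDist.norm_add_le_max _ _).trans_lt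
        (max_lt h1 (h2.trans_le (min_le_right _ _)))
    change ‖(coeff d c).1 - _‖ < ε
    rw [hgy, h3, sub_add_cancel_left, norm_neg]
    exact h2.trans_le (min_le_left _ _)
  intro f hf
  refine mem_closure_of_forall_exists fun F ε hε => ?_
  obtain ⟨m, hm, hdec⟩ := key (min ε 1) (lt_min hε one_pos)
  obtain ⟨g, hg, hfg, hgc⟩ := hdec f hf
  choose e he y hy hgy using hgc
  let c : Fin (p ^ m) → MvPowerSeries (Fin n) k := fun i d => ⟨e i d, he i d⟩
  have hcc : ∀ i d, (coeff d (c i)).1 = e i d := fun i d => rfl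
  have htR : t ∈ valRing L := ⟨htL, ht1.le⟩
  refine ⟨∑ i : Fin (p ^ m), MvPowerSeries.C ((⟨t, htR⟩ : valRing L) ^ (i : ℕ)) *
    MvPowerSeries.map (h.residue.inclusion le_rfl) (c i), ?_, fun d _ => ?_⟩
  · refine Ideal.sum_mem _ fun i _ => Ideal.mul_mem_left _ _ (Ideal.mem_map_of_mem _ ?_)
    refine hred (g i) (hg i) (c i) fun d => ?_
    rw [hcc, hgy, add_sub_cancel_left]
    exact (hm _ (hy i d)).trans_le (min_le_right _ _)
  · have : (coeff d (∑ i : Fin (p ^ m), MvPowerSeries.C ((⟨t, htR⟩ : valRing L) ^ (i : ℕ)) *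
        MvPowerSeries.map (h.residue.inclusion le_rfl) (c i))).1 =
        ∑ i : Fin (p ^ m), t ^ (i : ℕ) * e i d := by
      rw [map_sum]
      simp only [coeff_C_mul, coeff_map]
      exact map_sum (valRing L).subtype _ _
    rw [this, hfg, ← Finset.sum_sub_distrib]
    have hlt : ∀ i ∈ (Finset.univ : Finset (Fin (p ^ m))), ‖t ^ (i : ℕ) * (coeff d (g i)).1 - t ^ (i : ℕ) * e i d‖ ≤
        ‖t‖ ^ p ^ m := fun i _ => by
      rw [hgy, ← mul_sub, add_sub_cancel_left, norm_mul, norm_mul, norm_pow, norm_pow]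
      refine (mul_le_of_le_one_left (by positivity) (pow_le_one₀ ht0.le ht1.le)).trans ?_
      exact mul_le_of_le_one_right (by positivity) (hy i d).2
    refine (IsUltrametricDist.norm_sum_le_of_forall_le_of_nonneg (by positivity) hlt).trans_lt ?_
    have := hm 1 (valRing L).one_mem
    rw [mul_one, norm_pow] at this
    exact this.trans_le (min_le_left _ _)

theorem isDefinedOver (h : IsLocalSubfield k L) {X : ClosedFormalSubscheme (valRing L) n} {m₀ : ℕ}
    (hX : ∀ m, m₀ ≤ m → ∃ T : Set H.Points, (∀ v ∈ T, IsRational (powField p m L) v) ∧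
      X.ideal = vanishing L T) : X.IsDefinedOver (h.residue.inclusion le_rfl) := by
  have hcont : Continuous (h.residue.inclusion (le_refl L)) :=
    Continuous.subtype_mk continuous_subtype_val _
  refine ⟨⟨X.ideal.comap (MvPowerSeries.map (h.residue.inclusion le_rfl)),
    X.isClosed.preimage (continuous_map hcont)⟩, ?_⟩
  have : ((X.ideal.comap (MvPowerSeries.map (h.residue.inclusion le_rfl))).map
      (MvPowerSeries.map (h.residue.inclusion le_rfl))).closure = X.ideal := by
    refine SetLike.coe_injective ?_
    rw [Ideal.coe_closure]
    exact (closure_minimal Ideal.map_comap_le X.isClosed).antisymm (h.le_closure_map_comap hX)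
  cases X
  simp only [ClosedFormalSubscheme.baseChange, this]

/-- Multiplication by `p ^ m` maps points over `L` to points over the field of `p ^ m`-th powers
of `L`, for a formal group over `k`. -/
theorem isRational_nsmul (h : IsLocalSubfield k L) (G : CommFormalGroup k n)
    (φ : k →+* valRing (⊤ : Subfield C)) (hφ : ∀ c, (φ c : C) = c) {v : (G.map φ).Points}
    (hv : IsRational L v) (m : ℕ) : IsRational (powField p m L) (p ^ m • v) := by
  have : CharP (valRing (⊤ : Subfield C)) p :=
    (valRing (⊤ : Subfield C)).subtype.charP Subtype.val_injective p
  induction m with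
  | zero =>
    intro i
    exact ⟨_, hv i, by simp⟩
  | succ m ih =>
    intro i
    rw [pow_succ', mul_nsmul']
    refine ((coord_nsmul_mem G φ p ((valRing (powField p (m + 1) L)).comap
      (valRing (⊤ : Subfield C)).subtype) (h.isClosed_valRing_powField.preimage
        continuous_subtype_val) (fun c => ?_) (p ^ m • v) fun l => ?_) i).1
    · change (φ c : C) ∈ valRing (powField p (m + 1) L)
      rw [hφ]
      exact h.le_valRing_powField c.2
    · obtain ⟨y, hy, hyl⟩ := mem_powField.1 (ih l)
      refine ⟨⟨y, hy, ?_⟩, ?_⟩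
      · change y ^ p ^ (m + 1) = ((p ^ m • v).coord l : C) ^ p
        rw [← hyl, ← pow_mul, pow_succ]
      · change ‖((p ^ m • v).coord l : C) ^ p‖ ≤ 1
        rw [norm_pow]
        exact pow_le_one₀ (norm_nonneg _) ((p ^ m • v).coord l).2.2

end IsLocalSubfield

end Descent

/-! ### Points over subfields -/

section Points

variable {C : Type*} [NormedField C] [IsUltrametricDist C] [CompleteSpace C]
  {k : Type*} [CommRing k] {n : ℕ} {G : CommFormalGroup k n}
  {L : Subfield C} [CompleteSpace L] {φL : k →+* valRing L} {φ : k →+* valRing (⊤ : Subfield C)}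

/-- Points over the valuation ring of `L`, seen as points over the valuation ring of `C`. -/
def toTop (hφ : ∀ c, (φ c : C) = φL c) : (G.map φL).Points →+ (G.map φ).Points :=
  Points.map (inclusion le_top) (continuous_inclusion _) fun i => by
    change MvPowerSeries.map φ _ = MvPowerSeries.map _ (MvPowerSeries.map φL _)
    rw [← RingHom.comp_apply (MvPowerSeries.map _), ← MvPowerSeries.map_comp]
    congr 2
    ext c
    exact hφ c

variable (hφ : ∀ c, (φ c : C) = φL c)

theorem isRational_toTop (v : (G.map φL).Points) : IsRational L (toTop hφ v) :=
  fun i => (v.coord i).2.1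

theorem exists_toTop_eq {v : (G.map φ).Points} (hv : IsRational L v) : ∃ w, toTop hφ w = v := by
  refine ⟨⟨fun i => ⟨v.coord i, hv i, (v.coord i).2.2⟩, fun i => ?_⟩, Points.ext fun i => rfl⟩
  have h := (v.2 i).map (φ := (valRing (⊤ : Subfield C)).subtype) continuous_subtype_val
  exact tendsto_subtype_rng.2 h

theorem mem_vanishing_toTop {T : Set (G.map φL).Points} {f : MvPowerSeries (Fin n) (valRing L)} :
    f ∈ vanishing L (toTop hφ '' T) ↔ ∀ v ∈ T, aeval (R := valRing L) v.hasEval f = 0 := by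
  rw [mem_vanishing, Set.forall_mem_image]
  refine forall₂_congr fun v _ => ?_
  rw [← map_aeval (inclusion le_top) (continuous_inclusion _) v.hasEval (toTop hφ v).hasEval
    (fun _ => rfl)]
  exact map_eq_zero_iff _ (inclusion_injective _)

theorem vanishing_comap_translation (T : Set (G.map φL).Points) (w : (G.map φL).Points) :
    (vanishing L (toTop hφ '' T)).comap (translation w) =
      vanishing L (toTop hφ '' ((· + w) '' T)) := by
  ext f
  rw [Ideal.mem_comap, mem_vanishing_toTop, mem_vanishing_toTop, Set.forall_mem_image]
  simp only [aeval_translation]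

end Points

theorem ClosedFormalSubscheme.ext {A : Type*} [CommRing A] [TopologicalSpace A] {n : ℕ}
    {X Y : ClosedFormalSubscheme A n} (h : X.ideal = Y.ideal) : X = Y := by
  cases X
  cases Y
  congr

theorem ClosedFormalSubscheme.coe_baseChange_ideal {A B : Type*} [CommRing A] [CommRing B]
    [TopologicalSpace A] [TopologicalSpace B] [IsTopologicalRing B] {n : ℕ} (φ : A →+* B)
    (X : ClosedFormalSubscheme A n) :
    ((X.baseChange φ).ideal : Set (MvPowerSeries (Fin n) B)) =
      closure (X.ideal.map (MvPowerSeries.map φ)) :=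
  Ideal.coe_closure _

/-! ### Base change of vanishing ideals -/

section BaseChange

variable {C : Type*} [NormedField C] [IsUltrametricDist C] [CompleteSpace C]
  {n : ℕ} {H : CommFormalGroup (valRing (⊤ : Subfield C)) n}

theorem baseChange_ideal_le {M M' : Subfield C} (h : M ≤ M') {T : Set H.Points}
    {X : ClosedFormalSubscheme (valRing M) n} (hX : X.ideal = vanishing M T) :
    (X.baseChange (inclusion h)).ideal ≤ vanishing M' T := by
  rw [← SetLike.coe_subset_coe, ClosedFormalSubscheme.coe_baseChange_ideal, hX]
  exact closure_minimal (map_vanishing_le h T) (isClosed_vanishing M' T)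

/-- The base change to the completed perfection of `L` of the closure of a set of points with
coordinates in `L`. -/
theorem IsLocalSubfield.baseChange_ideal_eq [IsAlgClosed C] {k L : Subfield C}
    (h : IsLocalSubfield k L) (p : ℕ) [Fact p.Prime] [CharP C p] {M : Subfield C} (hLM : L ≤ M)
    (hM : M ≤ perfHat L) {T : Set H.Points} (hT : ∀ v ∈ T, IsRational L v)
    {X : ClosedFormalSubscheme (valRing M) n} (hX : X.ideal = vanishing M T) :
    (X.baseChange (inclusion hM)).ideal = vanishing (perfHat L) T := by
  refine le_antisymm (baseChange_ideal_le hM hX) ?_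
  rw [← SetLike.coe_subset_coe, ClosedFormalSubscheme.coe_baseChange_ideal, hX]
  refine (h.vanishing_perfHat_le p hT (hLM.trans hM)).trans (closure_mono ?_)
  rw [SetLike.coe_subset_coe]
  refine Ideal.map_le_iff_le_comap.2 fun f hf => ?_
  have := Ideal.mem_map_of_mem (MvPowerSeries.map (inclusion hM))
    ((map_mem_vanishing_iff hLM).2 hf)
  rw [← RingHom.comp_apply, ← MvPowerSeries.map_comp] at this
  exact this

end BaseChange

/-! ### The local field `K` and its purely inseparable extensions -/

section LocalField

variable {K : Type*} [NontriviallyNormedField K]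
  {C : Type*} [NormedField C] [IsUltrametricDist C] [NormedAlgebra K C] {k : Subfield C}

theorem coe_valRing_fieldRange : (valRing (algebraMap K C).fieldRange : Set C) =
    algebraMap K C '' Metric.closedBall 0 1 := by
  ext x
  constructor
  · rintro ⟨⟨y, rfl⟩, hy⟩
    exact ⟨y, by simpa using hy, rfl⟩
  · rintro ⟨y, hy, rfl⟩
    exact ⟨⟨y, rfl⟩, by simpa using hy⟩

variable [ProperSpace K]

theorem IsResidueField.isLocalSubfield (hk : IsResidueField k (algebraMap K C).fieldRange) :
    IsLocalSubfield k (algebraMap K C).fieldRange := by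
  have hcpt : IsCompact (valRing (algebraMap K C).fieldRange : Set C) := by
    rw [coe_valRing_fieldRange]
    exact (isCompact_closedBall _ _).image (algebraMapCLM K C).continuous
  refine ⟨hk, hcpt, ?_⟩
  obtain ⟨t, ht, hmax⟩ := (hcpt.inter_right
    (IsUltrametricDist.isClosed_ball (0 : C) 1)).exists_isMaxOn
    ⟨0, (valRing _).zero_mem, by simp⟩ continuous_norm.continuousOn
  have hmax' : ∀ x ∈ (algebraMap K C).fieldRange, ‖x‖ < 1 → ‖x‖ ≤ ‖t‖ := fun x hx hx1 =>
    hmax ⟨⟨hx, hx1.le⟩, by simpa using hx1⟩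
  refine ⟨t, ht.1.1, ?_, by simpa using ht.2, hmax'⟩
  obtain ⟨y, hy0, hy1⟩ := NormedField.exists_norm_lt_one K
  refine hy0.trans_le ?_
  rw [← norm_algebraMap' C y] at hy1 ⊢
  exact hmax' _ ⟨y, rfl⟩ hy1

/-- The field of `p ^ m`-th roots of the elements of `K` as an extension of `K`. -/
def rootExtension (K : Type*) [NontriviallyNormedField K] (C : Type*) [NormedField C]
    [NormedAlgebra K C] (p : ℕ) [Fact p.Prime] [CharP C p] (m : ℕ) : IntermediateField K C :=
  (rootField p m (algebraMap K C).fieldRange).toIntermediateField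
    fun x => le_rootField _ ⟨x, rfl⟩

theorem finiteDimensional_rootExtension [IsAlgClosed C] (p : ℕ) [Fact p.Prime] [CharP C p] (m : ℕ)
    (hk : IsResidueField k (algebraMap K C).fieldRange) :
    FiniteDimensional K (rootExtension K C p m) := by
  have h := hk.isLocalSubfield.toRootField (p := p) (m := m)
  refine FiniteDimensional.of_isCompact_closedBall K (r := 1) one_pos (c := 0) ?_
  rw [Topology.IsEmbedding.subtypeVal.isCompact_iff]
  convert h.isCompact using 1
  ext x
  constructor
  · rintro ⟨y, hy, rfl⟩
    exact ⟨y.2, by simpa using hy⟩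
  · rintro hx
    exact ⟨⟨x, hx.1⟩, by simpa using hx.2, rfl⟩

end LocalField

/-! ### Finitely generated `ℤ_p`-modules -/

section PadicModules

variable {p : ℕ} [Fact p.Prime] {M : Type*} [AddCommGroup M] [Module ℤ_[p] M]

theorem padic_smul_mem [TopologicalSpace M] [ContinuousSMul ℤ_[p] M] (A : AddSubgroup M)
    (hA : IsClosed (A : Set M)) (a : ℤ_[p]) {x : M} (hx : x ∈ A) : a • x ∈ A := by
  have hcl : IsClosed {a : ℤ_[p] | a • x ∈ A} :=
    hA.preimage (continuous_id.smul continuous_const)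
  refine PadicInt.denseRange_natCast.induction_on (p := fun a => a • x ∈ A) a hcl fun n => ?_
  rw [Nat.cast_smul_eq_nsmul]
  exact A.nsmul_mem hx n

variable [Module.Finite ℤ_[p] M]

variable (p) in
/-- A finitely generated `ℤ_p`-module is compact for the `p`-adic topology. -/
theorem exists_finset_cover (N : M → ℕ) :
    ∃ s : Finset M, ∀ x, ∃ y ∈ s, ∃ z, x = y + p ^ N y • z := by
  classical
  obtain ⟨r, f, hf⟩ := Module.Finite.exists_fin' ℤ_[p] M
  have hpos : ∀ a : Fin r → ℤ_[p], (0 : ℝ) < (p : ℝ) ^ (-(N (f a) : ℤ)) := fun a =>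
    zpow_pos (by exact_mod_cast (Fact.out : p.Prime).pos) _
  obtain ⟨s, -, hs⟩ := isCompact_univ.elim_nhds_subcover
    (fun a : Fin r → ℤ_[p] => Metric.ball a ((p : ℝ) ^ (-(N (f a) : ℤ))))
    fun a _ => Metric.ball_mem_nhds a (hpos a)
  refine ⟨s.image f, fun x => ?_⟩
  obtain ⟨b, rfl⟩ := hf x
  obtain ⟨a, ha, hab⟩ := Set.mem_iUnion₂.1 (hs (Set.mem_univ b))
  refine ⟨f a, Finset.mem_image_of_mem f ha, ?_⟩
  have hdiv : ∀ i, ∃ c, b i - a i = (p : ℤ_[p]) ^ N (f a) * c := fun i => by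
    have h1 : ‖b i - a i‖ ≤ (p : ℝ) ^ (-(N (f a) : ℤ)) := by
      rw [← dist_eq_norm]
      exact (dist_le_pi_dist b a i).trans (Metric.mem_ball.1 hab).le
    rw [PadicInt.norm_le_pow_iff_mem_span_pow] at h1
    exact Ideal.mem_span_singleton.1 h1
  choose c hc using hdiv
  refine ⟨f c, ?_⟩
  have : b = a + p ^ N (f a) • c := by
    ext1 i
    rw [Pi.add_apply, Pi.smul_apply, nsmul_eq_mul, Nat.cast_pow, ← hc]
    ring
  rw [← map_nsmul, ← map_add, ← this]

/-- If a finitely generated `ℤ_p`-module is the union of an increasing sequence of closed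
subgroups, it is equal to one of them. -/
theorem exists_forall_mem [TopologicalSpace M] [ContinuousSMul ℤ_[p] M]
    (A : ℕ → AddSubgroup M) (hmono : Monotone A) (hA : ∀ m, IsClosed (A m : Set M))
    (hex : ∀ x, ∃ m, x ∈ A m) : ∃ m, ∀ x, x ∈ A m := by
  obtain ⟨s, hs⟩ := (Module.Finite.fg_top : (⊤ : Submodule ℤ_[p] M).FG)
  choose μ hμ using hex
  refine ⟨s.sup μ, fun x => ?_⟩
  have hx : x ∈ Submodule.span ℤ_[p] (s : Set M) := hs ▸ Submodule.mem_top
  induction hx using Submodule.span_induction with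
  | mem x hx => exact hmono (Finset.le_sup hx) (hμ x)
  | zero => exact (A _).zero_mem
  | add x y _ _ hx hy => exact (A _).add_mem hx hy
  | smul a x _ hx => exact padic_smul_mem _ (hA _) a hx

end PadicModules

/-! ### Points in a finitely generated `ℤ_p`-module -/

section Finiteness

variable {C : Type*} [NormedField C] [IsUltrametricDist C] [CompleteSpace C]
  {p : ℕ} [Fact p.Prime] [CharP C p] {k L : Subfield C} {n : ℕ} {G : CommFormalGroup k n}
  {φ : k →+* valRing (⊤ : Subfield C)}

theorem IsRational.add (h : IsLocalSubfield k L) (hφ : ∀ c, (φ c : C) = c)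
    {v w : (G.map φ).Points} (hv : IsRational L v) (hw : IsRational L w) :
    IsRational L (v + w) := by
  have : CompleteSpace L := h.isClosed.completeSpace_coe
  obtain ⟨v, rfl⟩ := exists_toTop_eq (φL := h.residue.inclusion le_rfl) hφ hv
  obtain ⟨w, rfl⟩ := exists_toTop_eq (φL := h.residue.inclusion le_rfl) hφ hw
  rw [← map_add]
  exact isRational_toTop hφ _

theorem IsRational.neg (h : IsLocalSubfield k L) (hφ : ∀ c, (φ c : C) = c)
    {v : (G.map φ).Points} (hv : IsRational L v) : IsRational L (-v) := by
  have : CompleteSpace L := h.isClosed.completeSpace_coe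
  obtain ⟨v, rfl⟩ := exists_toTop_eq (φL := h.residue.inclusion le_rfl) hφ hv
  rw [← map_neg]
  exact isRational_toTop hφ _

theorem continuous_coord {A : Type*} [CommRing A] [UniformSpace A] {G : CommFormalGroup A n}
    (i : Fin n) : Continuous fun v : G.Points => v.coord i :=
  (continuous_apply i).comp continuous_induced_dom

/-- A finitely generated `ℤ_p`-module of points over the perfection of `L` consists of points over
the field of `p ^ m`-th roots of the elements of `L`, for some `m`. -/
theorem exists_forall_isRational [IsAlgClosed C] (h : IsLocalSubfield k L) {P : Subfield C}
    [CompleteSpace P] {φP : k →+* valRing P} (hφP : ∀ c, (φ c : C) = φP c)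
    (hφ : ∀ c, (φ c : C) = c) (Γ : AddSubgroup (G.map φP).Points)
    [Module ℤ_[p] Γ] [ContinuousSMul ℤ_[p] Γ] [Module.Finite ℤ_[p] Γ]
    (hΓ : ∀ γ ∈ Γ, ∀ i, (γ.coord i : C) ∈ perf L) :
    ∃ m, ∀ γ : Γ, IsRational (rootField p m L) (toTop hφP γ.1) := by
  have hloc := fun m => h.toRootField (p := p) (m := m)
  let A : ℕ → AddSubgroup Γ := fun m =>
    { carrier := {γ | IsRational (rootField p m L) (toTop hφP γ.1)}
      zero_mem' := fun i => (rootField p m L).zero_mem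
      add_mem' := fun {a b} ha hb => by
        change IsRational _ (toTop hφP (a.1 + b.1))
        rw [map_add]
        exact IsRational.add (hloc m) hφ ha hb
      neg_mem' := fun {a} ha => by
        change IsRational _ (toTop hφP (-a.1))
        rw [map_neg]
        exact IsRational.neg (hloc m) hφ ha }
  refine exists_forall_mem (p := p) A (fun m m' hmm γ hγ => hγ.mono (rootField_mono hmm _))
    (fun m => ?_) fun γ => ?_
  · have hset : (A m : Set Γ) = ⋂ i, {γ : Γ | (γ.1.coord i : C) ∈ rootField p m L} := by
      ext γ
      rw [Set.mem_iInter]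
      rfl
    rw [hset]
    exact isClosed_iInter fun i => (hloc m).isClosed.preimage
      (continuous_subtype_val.comp ((continuous_coord i).comp continuous_subtype_val))
  · choose μ hμ using fun i => (mem_perf_iff (p := p)).1 (hΓ γ γ.2 i)
    exact ⟨Finset.univ.sup μ, fun i =>
      rootField_mono (Finset.le_sup (Finset.mem_univ i)) _ (hμ i)⟩

/-- A set of points in a finitely generated `ℤ_p`-module of points over `L` is a finite union of
sets, each of which has a Zariski closure with a translate defined over `k`. -/
theorem exists_cover_isDefinedOver [CompleteSpace L] (h : IsLocalSubfield k L)
    {φL : k →+* valRing L} (hφL : ∀ c, (φ c : C) = φL c) (hφ : ∀ c, (φ c : C) = c)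
    {Γ : Type*} [AddCommGroup Γ] [Module ℤ_[p] Γ] [Module.Finite ℤ_[p] Γ]
    (e : Γ →+ (G.map φL).Points) (T : Set Γ) :
    ∃ (s : ℕ) (γ : Fin s → Γ) (S : Fin s → Set Γ), T = ⋃ i, S i ∧
      ∀ i, (translate (zariskiClosure L (toTop hφL '' (e '' S i))) (e (-γ i))).IsDefinedOver
        (h.residue.inclusion le_rfl) := by
  -- the part of `T` in the residue class of `γ` modulo `p ^ N`
  let S : Γ → ℕ → Set Γ := fun γ N => {δ | δ ∈ T ∧ ∃ z, δ = γ + p ^ N • z}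
  have hS : ∀ γ, Antitone (S γ) := by
    rintro γ N N' hN δ ⟨hδ, z, rfl⟩
    refine ⟨hδ, p ^ (N' - N) • z, ?_⟩
    rw [← mul_nsmul', ← pow_add, Nat.add_sub_cancel' hN]
  have hstab : ∀ γ : Γ, ∃ N, ∀ N', N ≤ N' → vanishing L (toTop hφL '' (e '' S γ N)) =
      vanishing L (toTop hφL '' (e '' S γ N')) := by
    intro γ
    have := h.isNoetherianRing
    exact monotone_stabilizes_iff_noetherian.2
      (inferInstance : IsNoetherianRing (MvPowerSeries (Fin n) (valRing L)))
      ⟨fun N => vanishing L (toTop hφL '' (e '' S γ N)), fun N N' hN =>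
        vanishing_anti _ (Set.image_mono (Set.image_mono (hS γ hN)))⟩
  choose N hN using hstab
  obtain ⟨s, hs⟩ := exists_finset_cover p N
  let γ : Fin s.card → Γ := fun i => s.equivFin.symm i
  refine ⟨s.card, γ, fun i => S (γ i) (N (γ i)), ?_, fun i => ?_⟩
  · refine Set.Subset.antisymm (fun δ hδ => ?_) (Set.iUnion_subset fun i δ hδ => hδ.1)
    obtain ⟨y, hy, z, hz⟩ := hs δ
    have hγy : γ (s.equivFin ⟨y, hy⟩) = y := by simp [γ]
    exact Set.mem_iUnion.2 ⟨s.equivFin ⟨y, hy⟩, hδ, z, by rw [hγy]; exact hz⟩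
  · refine h.isDefinedOver (H := G.map φ) (p := p) (m₀ := N (γ i)) fun M hM => ?_
    refine ⟨toTop hφL '' ((· + e (-γ i)) '' (e '' S (γ i) M)), ?_, ?_⟩
    · rintro _ ⟨_, ⟨_, ⟨δ, ⟨-, z, hz⟩, rfl⟩, rfl⟩, rfl⟩
      have : toTop hφL (e δ + e (-γ i)) = p ^ M • toTop hφL (e z) := by
        rw [← map_add, ← map_nsmul, ← map_nsmul, hz]
        congr 2
        abel
      simp only [this]
      exact h.isRational_nsmul G φ hφ (isRational_toTop hφL _) M
    · change (vanishing L (toTop hφL '' (e '' S (γ i) (N (γ i))))).comap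
        (translation (e (-γ i))) = _
      rw [hN (γ i) M hM, vanishing_comap_translation]

/-- A homomorphism to points over `C` whose values have coordinates in `L` lifts to the points
over `L`. -/
theorem exists_lift [CompleteSpace L] {φL : k →+* valRing L} (hφL : ∀ c, (φ c : C) = φL c)
    {Γ : Type*} [AddCommGroup Γ] (j : Γ →+ (G.map φ).Points) (hj : ∀ γ, IsRational L (j γ)) :
    ∃ e : Γ →+ (G.map φL).Points, ∀ γ, toTop hφL (e γ) = j γ := by
  choose e he using fun γ => exists_toTop_eq hφL (hj γ)
  have hinj : Function.Injective (toTop (G := G) hφL) := fun v w hvw => Points.ext fun i =>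
    Subtype.ext (congrArg (fun z : (G.map φ).Points => (z.coord i : C)) hvw)
  exact ⟨AddMonoidHom.mk' e fun a b => hinj (by rw [map_add, he, he, he, map_add]), he⟩

/-- A closed formal subscheme in which a set `T` of its points is dense is cut out by the ideal of
power series vanishing on `T`. -/
theorem ideal_eq_vanishing {P : Subfield C} [CompleteSpace P] {φP : k →+* valRing P}
    (hφP : ∀ c, (φ c : C) = φP c) {X : ClosedFormalSubscheme (valRing P) n}
    {T : Set (G.map φP).Points} (hX : FormallyDense T X) :
    X.ideal = vanishing P (toTop hφP '' T) :=
  (hX.2 (zariskiClosure P (toTop hφP '' T))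
    (fun f hf => (mem_vanishing_toTop hφP).2 fun v hv => hX.1 v hv f hf)
    fun v hv _ hf => (mem_vanishing_toTop hφP).1 hf v hv).symm

end Finiteness

end FormalML

end

open FormalML FormalML.CommFormalGroup in
/-- `K` is a local field of characteristic `p` with valuation ring `R`, and `C` is a complete
algebraically closed valued field extending `K`, such as the completion of an algebraic closure of
`K`. The subfield `k` of `R` is the residue field of `R`. -/
theorem theorem4p1 (p : ℕ) [Fact p.Prime]
    (K : Type*) [NontriviallyNormedField K] [ProperSpace K] [CharP K p]
    (C : Type*) [NormedField C] [IsUltrametricDist C] [CompleteSpace C] [IsAlgClosed C]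
    [NormedAlgebra K C]
    (k : Subfield C) (hk : FormalML.IsResidueField k (algebraMap K C).fieldRange)
    (n : ℕ) (G : FormalML.CommFormalGroup k n)
    -- a finitely generated `ℤ_p`-module `Γ` contained in `G(R^per)`; the `ℤ_p`-module structure
    -- is the unique continuous one
    (Γ : AddSubgroup
      (G.map (hk.inclusion (FormalML.le_perfHat (algebraMap K C).fieldRange))).Points)
    [Module ℤ_[p] Γ] [ContinuousSMul ℤ_[p] Γ] [Module.Finite ℤ_[p] Γ]
    (hΓ : ∀ γ ∈ Γ, ∀ i, (γ.coord i : C) ∈ FormalML.perf (algebraMap K C).fieldRange)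
    -- a closed formal subscheme `X` of the base change of `G` to `Spf R^per`
    (X : FormalML.ClosedFormalSubscheme
      (FormalML.valRing (FormalML.perfHat (algebraMap K C).fieldRange)) n)
    (hX : FormalML.CommFormalGroup.FormallyDense {v | v.LiesOn X ∧ v ∈ Γ} X) :
    -- a finite extension `K'` of `K` with valuation ring `R'` and residue field `k'`
    ∃ (K' : IntermediateField K C) (_ : FiniteDimensional K K')
      (k' : Subfield C) (hk' : FormalML.IsResidueField k' K'.toSubfield)
      -- the base change of `X` to `R'^per` is defined over `R'`, by `X'`
      (X' : FormalML.ClosedFormalSubscheme (FormalML.valRing K'.toSubfield) n)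
      (m : ℕ) (Y : Fin m → FormalML.ClosedFormalSubscheme (FormalML.valRing K'.toSubfield) n)
      (γ : Fin m → Γ)
      (γ' : Fin m → (G.map (hk.inclusion K'.fieldRange_le)).Points),
      X'.baseChange (FormalML.inclusion (FormalML.le_perfHat K'.toSubfield)) =
          X.baseChange (FormalML.inclusion (FormalML.perfHat_mono K'.fieldRange_le)) ∧
        -- each `Y j` is a closed formal subscheme of `X'`
        (∀ j, X'.ideal ≤ (Y j).ideal) ∧
        -- `γ j` has coordinates in `R'`; as a point with values in `R'` it is `γ' j`
        (∀ j i, ((γ' j).coord i : C) = ((γ j).1.coord i : C)) ∧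
        -- the translate of `Y j` by `γ j` is defined over `k'`
        (∀ j, (FormalML.CommFormalGroup.translate (Y j) (γ' j)).IsDefinedOver
          (hk'.inclusion le_rfl)) ∧
        -- after base change to `R'^per`, `X` is the union of the `Y j`
        (X.baseChange (FormalML.inclusion (FormalML.perfHat_mono K'.fieldRange_le))).IsUnion
          (fun j => (Y j).baseChange (FormalML.inclusion (FormalML.le_perfHat K'.toSubfield))) := by
  have : CharP C p := charP_of_injective_algebraMap (algebraMap K C).injective p
  have h₀ := hk.isLocalSubfield
  let φ : k →+* valRing (⊤ : Subfield C) := hk.inclusion le_top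
  let j₀ : (G.map (hk.inclusion (le_perfHat _))).Points →+ (G.map φ).Points :=
    toTop fun _ => rfl
  let j : Γ →+ (G.map φ).Points := j₀.comp Γ.subtype
  obtain ⟨m, hm⟩ : ∃ m, ∀ γ : Γ,
      IsRational (rootField p m (algebraMap K C).fieldRange) (j γ) :=
    exists_forall_isRational (G := G) (φ := φ) (φP := hk.inclusion (le_perfHat _)) h₀
      (fun _ => rfl) (fun _ => rfl) Γ hΓ
  let K' := rootExtension K C p m
  have hK' : FiniteDimensional K K' := finiteDimensional_rootExtension p m hk
  have h : IsLocalSubfield k K'.toSubfield := h₀.toRootField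
  -- `j` embeds `Γ` into the points over `C`, and `e` into the points over `K'`
  obtain ⟨e, he⟩ := exists_lift (φL := hk.inclusion K'.fieldRange_le) (fun _ => rfl) j hm
  let T : Set Γ := {γ | γ.1.LiesOn X}
  have hX' : X.ideal = vanishing _ (j '' T) := by
    refine (ideal_eq_vanishing (G := G) (φ := φ) (φP := hk.inclusion (le_perfHat _))
      (fun _ => rfl) hX).trans (congrArg _ ?_)
    refine Set.ext fun v => ⟨?_, ?_⟩
    · rintro ⟨w, hw, rfl⟩
      exact ⟨⟨w, hw.2⟩, hw.1, rfl⟩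
    · rintro ⟨w, hw, rfl⟩
      exact ⟨w.1, ⟨hw, w.2⟩, rfl⟩
  obtain ⟨s, γ, S, hTS, hdef⟩ := exists_cover_isDefinedOver (p := p) (φ := φ) h
    (φL := hk.inclusion K'.fieldRange_le) (fun _ => rfl) (fun _ => rfl) e T
  have himage : ∀ U : Set Γ, toTop (φ := φ) (φL := hk.inclusion K'.fieldRange_le)
      (fun _ => rfl) '' (e '' U) = j '' U := fun U => by
    rw [Set.image_image]
    simp only [he]
  simp only [himage] at hdef
  have hrat : ∀ (U : Set Γ), ∀ v ∈ j '' U, IsRational K'.toSubfield v := by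
    rintro U _ ⟨δ, -, rfl⟩
    exact hm δ
  have hbase : ∀ U : Set Γ,
      ((zariskiClosure K'.toSubfield (j '' U)).baseChange
        (inclusion (le_perfHat K'.toSubfield))).ideal =
      vanishing (perfHat K'.toSubfield) (j '' U) := fun U =>
    h.baseChange_ideal_eq p le_rfl _ (hrat U) rfl
  have hXbase : (X.baseChange (inclusion (perfHat_mono K'.fieldRange_le))).ideal =
      vanishing (perfHat K'.toSubfield) (j '' T) :=
    h.baseChange_ideal_eq p (rootField_le_perfHat _) _ (hrat T) hX'
  -- translation by `-γ i` moves the residue class of `γ i` to that of `0`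
  refine ⟨K', hK', k, h.residue, zariskiClosure K'.toSubfield (j '' T), s,
    fun i => zariskiClosure K'.toSubfield (j '' S i), fun i => -γ i,
    fun i => e (-γ i), ?_, ?_, ?_, hdef, ?_⟩
  · exact ClosedFormalSubscheme.ext ((hbase T).trans hXbase.symm)
  · exact fun i => vanishing_anti _ (Set.image_mono (hTS ▸ Set.subset_iUnion S i))
  · intro i c
    exact congrArg (fun z : (G.map φ).Points => (z.coord c : C)) (he (-γ i))
  · change _ = ⨅ i, _
    simp only [hbase]
    rw [hXbase, hTS, Set.image_iUnion, vanishing_iUnion]
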